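/- For $0<\rho<1/2$ let $C_\rho\subset\mathbb R$ be the central Cantor set with ratio $\rho$, i.e. the attractor (the unique non-empty compact set $K$ with $K=\rho K\cup(\rho K+1-\rho)$) of the maps $x\mapsto\rho x$ and $x\mapsto\rho x+1-\rho$. A set $A\subset\mathbb R$ can be affinely embedded into $B\subset\mathbb R$ if there are $M,a\in\mathbb R$ with $M\ne0$ and $MA+a\subseteq B$. A Pisot number is a real algebraic integer $\theta>1$ all of whose algebraic conjugates other than $\theta$ itself have absolute value strictly less than $1$. Theorem 1.4. Let $0<\beta<\alpha<1/2$. (i) If $\alpha<1/4$, then $C_\beta$ can be affinely embedded into $C_\alpha$ if and only if $\log\beta/\log\alpha\in\mathbb N$. (ii) If $1/4\le\alpha<\sqrt2-1$ and $C_\beta$ can be affinely embedded into $C_\alpha$, then $\log\beta/\log\alpha\in\mathbb Q$. However, $\log\beta/\log\alpha$ need not be an integer: there exist $\alpha,\beta$ with $0<\beta<\alpha$ and $1/4\le\alpha<\sqrt2-1$ such that $C_\beta$ can be affinely embedded into $C_\alpha$ and $\log\beta/\log\alpha\notin\mathbb N$. (iii) If $1/\alpha$ is a Pisot number and $C_\beta$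 can be affinely embedded into $C_\alpha$, then $\log\beta/\log\alpha\in\mathbb Q$ and $1/\beta$ is a Pisot number. -/

import Mathlib

open Filter Topology

/-- `K` is the attractor of the finite family `φ` of maps: a non-empty compact set with
`K = ⋃ i, φ i (K)`. -/
def IsAttractor {X ι : Type*} [TopologicalSpace X] (φ : ι → X → X) (K : Set X) : Prop :=
  K.Nonempty ∧ IsCompact K ∧ K = ⋃ i, φ i '' K

/-- The attractor of `φ`, written as the union of all sets that satisfy `IsAttractor φ`. For an
iterated function system there is exactly one such set, and this is that set. -/
def attractor {X ι : Type*} [TopologicalSpace X] (φ : ι → X → X) : Set X :=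
  ⋃₀ {K | IsAttractor φ K}

/-- The iterated function system `{ρ x, ρ x + 1 - ρ}` on the real line. -/
def centralIFS (ρ : ℝ) : Fin 2 → ℝ → ℝ :=
  ![fun x => ρ * x, fun x => ρ * x + (1 - ρ)]

/-- The central Cantor set `C_ρ`: the attractor of `{ρ x, ρ x + 1 - ρ}`. -/
def centralCantorSet (ρ : ℝ) : Set ℝ := attractor (centralIFS ρ)

/-- `A` can be affinely embedded into `B`, for subsets of the real line: `f(A) ⊆ B` for some
`f(x) = M x + a` with `M` an invertible `1 × 1` matrix, that is, a non-zero number. -/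
def AffinelyEmbeds (A B : Set ℝ) : Prop :=
  ∃ M a : ℝ, M ≠ 0 ∧ (fun x => M * x + a) '' A ⊆ B

/-- A Pisot number: a real algebraic integer `θ > 1` all of whose other (complex) algebraic
conjugates lie in the open unit disk. -/
def IsPisot (θ : ℝ) : Prop :=
  IsIntegral ℤ θ ∧ 1 < θ ∧
    ∀ z : ℂ, Polynomial.aeval z (minpoly ℚ θ) = 0 → z ≠ (θ : ℂ) → ‖z‖ < 1

/-- The set of all sums `∑ ε_i (1 - ρ) ρ ^ i` with digits `ε_i ∈ {0, 1}`. -/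
def cantorSums (ρ : ℝ) : Set ℝ :=
  Set.range fun ε : ℕ → Fin 2 => ∑' i, ((ε i : ℕ) : ℝ) * ((1 - ρ) * ρ ^ i)

theorem centralIFS_apply (ρ : ℝ) (i : Fin 2) (x : ℝ) :
    centralIFS ρ i x = ρ * x + ((i : ℕ) : ℝ) * (1 - ρ) := by
  fin_cases i <;> simp [centralIFS]

theorem cantorSums_norm_le {ρ : ℝ} (h0 : 0 < ρ) (h1 : ρ < 1) (k : Fin 2) (i : ℕ) :
    ‖((k : ℕ) : ℝ) * ((1 - ρ) * ρ ^ i)‖ ≤ (1 - ρ) * ρ ^ i := by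
  have h : 0 ≤ (1 - ρ) * ρ ^ i := mul_nonneg (by linarith) (by positivity)
  rw [norm_mul, Real.norm_of_nonneg h]
  fin_cases k <;> simp [h]

theorem cantorSums_summable {ρ : ℝ} (h0 : 0 < ρ) (h1 : ρ < 1) (ε : ℕ → Fin 2) :
    Summable fun i => ((ε i : ℕ) : ℝ) * ((1 - ρ) * ρ ^ i) :=
  Summable.of_norm_bounded ((summable_geometric_of_lt_one h0.le h1).mul_left (1 - ρ))
    fun i => cantorSums_norm_le h0 h1 (ε i) i

theorem cantorSums_step {ρ : ℝ} (h0 : 0 < ρ) (h1 : ρ < 1) (ε : ℕ → Fin 2) :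
    ∑' i, ((ε i : ℕ) : ℝ) * ((1 - ρ) * ρ ^ i) =
      centralIFS ρ (ε 0) (∑' i, ((ε (i + 1) : ℕ) : ℝ) * ((1 - ρ) * ρ ^ i)) := by
  rw [(cantorSums_summable h0 h1 ε).tsum_eq_zero_add, centralIFS_apply, ← tsum_mul_left, add_comm]
  congr 1
  · congr 1
    funext i
    ring
  · ring

theorem isAttractor_cantorSums {ρ : ℝ} (h0 : 0 < ρ) (h1 : ρ < 1) :
    IsAttractor (centralIFS ρ) (cantorSums ρ) := by
  refine ⟨Set.range_nonempty _, isCompact_range ?_, ?_⟩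
  · refine continuous_tsum (fun i => ?_)
      ((summable_geometric_of_lt_one h0.le h1).mul_left (1 - ρ))
      fun i ε => cantorSums_norm_le h0 h1 (ε i) i
    have : Continuous fun k : Fin 2 => ((k : ℕ) : ℝ) := continuous_of_discreteTopology
    exact (this.comp (continuous_apply i)).mul continuous_const
  · ext x
    simp only [Set.mem_iUnion]
    constructor
    · rintro ⟨ε, rfl⟩
      exact ⟨ε 0, _, ⟨fun i => ε (i + 1), rfl⟩, (cantorSums_step h0 h1 ε).symm⟩
    · rintro ⟨k, _, ⟨ε, rfl⟩, rfl⟩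
      refine ⟨fun i => Nat.casesOn i k ε, ?_⟩
      exact cantorSums_step h0 h1 _

/-- The attractor of `{ρ x, ρ x + 1 - ρ}` is unique, and consists of the sums above. -/
theorem IsAttractor.eq_cantorSums {ρ : ℝ} (h0 : 0 < ρ) (h1 : ρ < 1) {K : Set ℝ}
    (hK : IsAttractor (centralIFS ρ) K) : K = cantorSums ρ := by
  obtain ⟨⟨y, hy⟩, hc, hfix⟩ := hK
  have key : ∀ (ε : ℕ → Fin 2) (u : ℕ → ℝ), (∀ n, u n ∈ K) →
      Tendsto (fun n => ∑ i ∈ Finset.range n, ((ε i : ℕ) : ℝ) * ((1 - ρ) * ρ ^ i) + ρ ^ n * u n)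
        atTop (𝓝 (∑' i, ((ε i : ℕ) : ℝ) * ((1 - ρ) * ρ ^ i))) := by
    intro ε u hu
    obtain ⟨C, hC⟩ := hc.isBounded.exists_norm_le
    have hz : Tendsto (fun n => ρ ^ n * u n) atTop (𝓝 0) := by
      refine squeeze_zero_norm (a := fun n => ρ ^ n * C) (fun n => ?_) ?_
      · rw [norm_mul, norm_pow, Real.norm_of_nonneg h0.le]
        exact mul_le_mul_of_nonneg_left (hC _ (hu n)) (by positivity)
      · simpa using (tendsto_pow_atTop_nhds_zero_of_lt_one h0.le h1).mul_const C
    simpa using (cantorSums_summable h0 h1 ε).hasSum.tendsto_sum_nat.add hz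
  apply Set.Subset.antisymm
  · intro x hx
    have hstep : ∀ z : K, ∃ p : Fin 2 × K, (z : ℝ) = centralIFS ρ p.1 p.2 := by
      rintro ⟨z, hz⟩
      rw [hfix] at hz
      obtain ⟨k, w, hw, rfl⟩ := Set.mem_iUnion.1 hz
      exact ⟨(k, ⟨w, hw⟩), rfl⟩
    choose p hp using hstep
    let v : ℕ → K := fun n => (fun z => (p z).2)^[n] ⟨x, hx⟩
    have hv : ∀ n, (v n : ℝ) = centralIFS ρ (p (v n)).1 (v (n + 1)) := by
      intro n
      have : v (n + 1) = (p (v n)).2 := Function.iterate_succ_apply' _ _ _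
      rw [this]
      exact hp _
    have hx' : ∀ n, ∑ i ∈ Finset.range n, (((p (v i)).1 : ℕ) : ℝ) * ((1 - ρ) * ρ ^ i)
        + ρ ^ n * (v n : ℝ) = x := by
      intro n
      induction n with
      | zero => simp [v]
      | succ n ih =>
        rw [← ih, Finset.sum_range_succ, hv n, centralIFS_apply]
        ring
    have h := key (fun i => (p (v i)).1) (fun n => v n) fun n => (v n).2
    simp only [hx'] at h
    exact ⟨_, tendsto_nhds_unique tendsto_const_nhds h |>.symm⟩
  · rintro _ ⟨ε, rfl⟩
    have hmem : ∀ (n : ℕ) (δ : ℕ → Fin 2),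
        ∑ i ∈ Finset.range n, ((δ i : ℕ) : ℝ) * ((1 - ρ) * ρ ^ i) + ρ ^ n * y ∈ K := by
      intro n
      induction n with
      | zero => intro δ; simpa using hy
      | succ n ih =>
        intro δ
        rw [hfix]
        refine Set.mem_iUnion.2 ⟨δ 0, _, ih fun i => δ (i + 1), ?_⟩
        rw [centralIFS_apply, Finset.sum_range_succ', mul_add, Finset.mul_sum]
        have : ∀ i, ρ * (((δ (i + 1) : ℕ) : ℝ) * ((1 - ρ) * ρ ^ i)) =
            ((δ (i + 1) : ℕ) : ℝ) * ((1 - ρ) * ρ ^ (i + 1)) := fun i => by ring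
        simp only [this]
        ring
    exact hc.isClosed.mem_of_tendsto (key ε (fun _ => y) fun _ => hy)
      (Eventually.of_forall fun n => hmem n ε)

theorem centralCantorSet_eq_cantorSums {ρ : ℝ} (h0 : 0 < ρ) (h1 : ρ < 1) :
    centralCantorSet ρ = cantorSums ρ := by
  apply Set.Subset.antisymm
  · rintro x ⟨K, hK, hx⟩
    exact hK.eq_cantorSums h0 h1 ▸ hx
  · exact fun x hx => ⟨_, isAttractor_cantorSums h0 h1, hx⟩

/-- `centralCantorSet ρ` is indeed the attractor of `{ρ x, ρ x + 1 - ρ}`. -/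
theorem isAttractor_centralCantorSet {ρ : ℝ} (h0 : 0 < ρ) (h1 : ρ < 1) :
    IsAttractor (centralIFS ρ) (centralCantorSet ρ) :=
  centralCantorSet_eq_cantorSums h0 h1 ▸ isAttractor_cantorSums h0 h1

/-!
Throughout, `K_ρ = {∑ ε_i ρ ^ i : ε_i ∈ {0, 1}}` is `C_ρ` rescaled by `1 / (1 - ρ)`. An embedding of
`C_β` into `C_α` provides `x` and `c > 0` such that `x + c ∑_{n ∈ S} β ^ n ∈ K_α` for every finite
set `S` (`exists_finsum_mem_of_affinelyEmbeds`); all necessary conditions are read off from this.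
Write `τ = log β / log α`.

For `α < 1 / 4` the differences `c β ^ n` of points of `K_α` are confined to intervals around the
powers of `α` which are so short that the rotation by `τ` keeps an orbit in an arc shorter than half
of the circle, and then `τ` is an integer (`exists_int_eq_of_orbit_mem_arc`). Conversely
`C_{α ^ n}` embeds into `C_α` by leaving digits zero, and the pair `α = γ ^ 2`, `β = γ ^ 3` with
`γ ^ 2 = 1 - γ` embeds because `β = α - α ^ 2` and `β ^ 2 = α ^ 3`.

If `τ` is irrational, the numbers `c β ^ n / α ^ k` are dense in `(0, ∞)`
(`exists_pow_mul_mem_Ioo`). For `α < √2 - 1` the number `1 / (1 + α) = 1 - α + α ^ 2 - …` is a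
difference of points of `K_α` in essentially one way, even approximately
(`abs_sub_le_of_sub_close`). When `c β ^ n` is very close to `α ^ k / (1 + α)`, this forces `x` and
`x + c β ^ (n + 1)`, both of which can be shifted by `c β ^ n` inside `K_α`, to be much too close to
each other.

If `θ = 1 / α` is a Pisot number, the blow-ups of `K_α` stay near elements of `ℤ[θ]` with bounded
conjugates. Comparing `2 ^ k` words of `k` digits with an interval of length `θ ^ k`, one finds
finitely many cosets of the near-lattice `θ ^ k Λ`, where `Λ` consists of the elements of `ℤ[θ]` with
conjugates at most `C`, which the differences of points of a blow-up, taken from a common base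
point, cannot all approach (`exists_coset_avoided`). Irrationality of `τ` contradicts this: since
`Λ` is relatively dense, nested intervals produce a scale at which the numbers `c β ^ n` approach
all of those cosets. If `τ = p / q`, so that `β ^ q = α ^ p`, one considers instead the
subsums of `u θ ^ (p i)` with `u = c β ^ r`. For `u ∉ ℚ(θ)` Pisot's theorem says that `ξ u θ ^ (p i)`
does not approach the integers for any non-zero `ξ ∈ ℚ(θ)`, so the Fourier coefficients of the
distribution of the subsums tend to zero and the subsums approach every coset
(`exists_finset_sum_near_coset`), again a contradiction. Hence `c` and `c β` lie in `ℚ(θ)`, and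
`β ∈ ℚ(θ)`. A conjugate of `1 / β` other than `1 / β` then comes from an embedding of `ℚ(θ)` that
moves `θ` inside the unit disk, and `(1 / β) ^ q = θ ^ p` bounds it (`IsPisot.of_pow_eq_pow`).
-/

/-! ### Digit expansions -/

/-- The set `K_ρ` of all sums `∑ ε_i ρ ^ i` with digits `ε_i ∈ {0, 1}`. It is `C_ρ` rescaled by
`1 / (1 - ρ)`, so that the first level maps become `x ↦ ρ x` and `x ↦ ρ x + 1`. -/
def digitSums (ρ : ℝ) : Set ℝ :=
  Set.range fun ε : ℕ → Fin 2 => ∑' i, ((ε i : ℕ) : ℝ) * ρ ^ i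

theorem mem_centralCantorSet_iff {ρ : ℝ} (h0 : 0 < ρ) (h1 : ρ < 1) {x : ℝ} :
    x ∈ centralCantorSet ρ ↔ ∃ y ∈ digitSums ρ, x = (1 - ρ) * y := by
  rw [centralCantorSet_eq_cantorSums h0 h1]
  have key : ∀ ε : ℕ → Fin 2, ∑' i, ((ε i : ℕ) : ℝ) * ((1 - ρ) * ρ ^ i) =
      (1 - ρ) * ∑' i, ((ε i : ℕ) : ℝ) * ρ ^ i := fun ε => by
    rw [← tsum_mul_left]
    exact tsum_congr fun i => by ring
  constructor
  · rintro ⟨ε, rfl⟩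
    exact ⟨_, ⟨ε, rfl⟩, key ε⟩
  · rintro ⟨_, ⟨ε, rfl⟩, rfl⟩
    exact ⟨ε, key ε⟩

theorem summable_digits {ρ : ℝ} (h0 : 0 < ρ) (h1 : ρ < 1) (ε : ℕ → Fin 2) :
    Summable fun i => ((ε i : ℕ) : ℝ) * ρ ^ i := by
  refine Summable.of_nonneg_of_le (fun i => by positivity) (fun i => ?_)
    (summable_geometric_of_lt_one h0.le h1)
  have : ((ε i : ℕ) : ℝ) ≤ 1 := by exact_mod_cast (by omega : (ε i : ℕ) ≤ 1)
  nlinarith [pow_pos h0 i]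

theorem digitSums_nonneg {ρ : ℝ} (h0 : 0 < ρ) {x : ℝ} (hx : x ∈ digitSums ρ) : 0 ≤ x := by
  obtain ⟨ε, rfl⟩ := hx
  exact tsum_nonneg fun i => by positivity

theorem digitSums_le {ρ : ℝ} (h0 : 0 < ρ) (h1 : ρ < 1) {x : ℝ} (hx : x ∈ digitSums ρ) :
    x ≤ (1 - ρ)⁻¹ := by
  obtain ⟨ε, rfl⟩ := hx
  rw [← tsum_geometric_of_lt_one h0.le h1]
  refine (summable_digits h0 h1 ε).tsum_le_tsum (fun i => ?_)
    (summable_geometric_of_lt_one h0.le h1)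
  have : ((ε i : ℕ) : ℝ) ≤ 1 := by exact_mod_cast (by omega : (ε i : ℕ) ≤ 1)
  nlinarith [pow_pos h0 i]

theorem digitSums_step {ρ : ℝ} (h0 : 0 < ρ) (h1 : ρ < 1) {x : ℝ} (hx : x ∈ digitSums ρ) :
    ∃ y ∈ digitSums ρ, x = ρ * y ∨ x = 1 + ρ * y := by
  obtain ⟨ε, rfl⟩ := hx
  refine ⟨_, ⟨fun i => ε (i + 1), rfl⟩, ?_⟩
  have h : ∑' i, ((ε i : ℕ) : ℝ) * ρ ^ i =
      ((ε 0 : ℕ) : ℝ) + ρ * ∑' i, ((ε (i + 1) : ℕ) : ℝ) * ρ ^ i := by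
    rw [(summable_digits h0 h1 ε).tsum_eq_zero_add, ← tsum_mul_left]
    simp only [pow_zero, mul_one]
    congr 1
    exact tsum_congr fun i => by ring
  simp only [h]
  rcases (by omega : (ε 0 : ℕ) = 0 ∨ (ε 0 : ℕ) = 1) with h | h <;> simp [h]

theorem mul_mem_digitSums {ρ : ℝ} (h0 : 0 < ρ) (h1 : ρ < 1) {y : ℝ} (hy : y ∈ digitSums ρ)
    (k : Fin 2) : ((k : ℕ) : ℝ) + ρ * y ∈ digitSums ρ := by
  obtain ⟨ε, rfl⟩ := hy
  refine ⟨fun i => Nat.casesOn i k ε, ?_⟩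
  rw [← tsum_mul_left]
  simp only
  rw [(summable_digits h0 h1 _).tsum_eq_zero_add]
  simp only [pow_zero, mul_one]
  congr 1
  exact tsum_congr fun i => by ring

theorem zero_mem_digitSums (ρ : ℝ) : 0 ∈ digitSums ρ := ⟨fun _ => 0, by simp⟩

theorem isClosed_digitSums {ρ : ℝ} (h0 : 0 < ρ) (h1 : ρ < 1) : IsClosed (digitSums ρ) := by
  refine (isCompact_range ?_).isClosed
  refine continuous_tsum (fun i => ?_) (summable_geometric_of_lt_one h0.le h1) fun i ε => ?_
  · have : Continuous fun k : Fin 2 => ((k : ℕ) : ℝ) := continuous_of_discreteTopology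
    exact (this.comp (continuous_apply i)).mul continuous_const
  · have : ((ε i : ℕ) : ℝ) ≤ 1 := by exact_mod_cast (by omega : (ε i : ℕ) ≤ 1)
    rw [Real.norm_of_nonneg (by positivity)]
    nlinarith [pow_pos h0 i]

/-- An embedding of `C_β` into `C_α` yields a point `x` and a scale `c > 0` such that all finite
sums `x + c ∑_{n ∈ S} β ^ n` lie in `K_α`. A negative scale is made positive by complementing the
digits, since `C_β` is symmetric about `1 / 2`. -/
theorem exists_finsum_mem_of_affinelyEmbeds {α β : ℝ} (hβ0 : 0 < β) (hβ1 : β < 1) (hα0 : 0 < α)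
    (hα1 : α < 1) (h : AffinelyEmbeds (centralCantorSet β) (centralCantorSet α)) :
    ∃ x c : ℝ, 0 < c ∧ ∀ S : Finset ℕ, x + c * ∑ n ∈ S, β ^ n ∈ digitSums α := by
  classical
  obtain ⟨M, a, hM, hsub⟩ := h
  have hα : 0 < 1 - α := by linarith
  have hβ : 0 < 1 - β := by linarith
  have mem : ∀ y ∈ digitSums β, a / (1 - α) + M * (1 - β) / (1 - α) * y ∈ digitSums α := by
    intro y hy
    have h1 := hsub ⟨_, (mem_centralCantorSet_iff hβ0 hβ1).2 ⟨y, hy, rfl⟩, rfl⟩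
    obtain ⟨z, hz, hzy⟩ := (mem_centralCantorSet_iff hα0 hα1).1 h1
    convert! hz using 1
    have : z = (M * ((1 - β) * y) + a) / (1 - α) := by field_simp; linarith
    rw [this]; ring
  have hfin : ∀ S : Finset ℕ, ∑' i, (((if i ∈ S then 1 else 0 : Fin 2) : ℕ) : ℝ) * β ^ i =
      ∑ n ∈ S, β ^ n := by
    intro S
    rw [tsum_eq_sum (s := S) (fun i hi => by simp [hi])]
    exact Finset.sum_congr rfl fun i hi => by simp [hi]
  rcases lt_or_gt_of_ne hM with hM | hM
  · refine ⟨a / (1 - α) + M * (1 - β) / (1 - α) * (1 - β)⁻¹, -(M * (1 - β) / (1 - α)), ?_, ?_⟩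
    · rw [← neg_div, ← neg_mul]
      have : 0 < -M := by linarith
      positivity
    · intro S
      have hc : ∑' i, (((if i ∈ S then 0 else 1 : Fin 2) : ℕ) : ℝ) * β ^ i =
          (1 - β)⁻¹ - ∑ n ∈ S, β ^ n := by
        rw [← hfin S, ← tsum_geometric_of_lt_one hβ0.le hβ1,
          ← (summable_geometric_of_lt_one hβ0.le hβ1).tsum_sub
            (summable_digits hβ0 hβ1 fun i => if i ∈ S then 1 else 0)]
        refine tsum_congr fun i => ?_
        split_ifs <;> simp
      have := mem _ ⟨fun i => if i ∈ S then 0 else 1, hc⟩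
      convert! this using 1
      ring
  · refine ⟨a / (1 - α), M * (1 - β) / (1 - α), by positivity, fun S => ?_⟩
    exact mem _ ⟨fun i => if i ∈ S then 1 else 0, hfin S⟩

/-- If the first level maps of `K_β` send `A (n + 1)` into `A n` for all `n`, if the sets `A n`
contain points forming a bounded sequence, and if `A 0` is closed, then `K_β ⊆ A 0`. -/
theorem digitSums_subset_of_step {β : ℝ} (h0 : 0 < β) (h1 : β < 1) (A : ℕ → Set ℝ)
    (hA : IsClosed (A 0)) (y : ℕ → ℝ) (hy : ∀ n, y n ∈ A n) (C : ℝ) (hC : ∀ n, ‖y n‖ ≤ C)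
    (hstep : ∀ n (k : Fin 2), ∀ x ∈ A (n + 1), ((k : ℕ) : ℝ) + β * x ∈ A n) :
    digitSums β ⊆ A 0 := by
  rintro _ ⟨ε, rfl⟩
  have hmem : ∀ (n m : ℕ) (δ : ℕ → Fin 2) (z : ℝ), z ∈ A (m + n) →
      ∑ i ∈ Finset.range n, ((δ i : ℕ) : ℝ) * β ^ i + β ^ n * z ∈ A m := by
    intro n
    induction n with
    | zero => intro m δ z hz; simpa using hz
    | succ n ih =>
      intro m δ z hz
      have h2 := hstep m (δ 0) _ (ih (m + 1) (fun i => δ (i + 1)) z (by convert! hz using 2; ring))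
      rw [Finset.sum_range_succ']
      convert! h2 using 1
      rw [mul_add, Finset.mul_sum]
      have : ∀ i, β * (((δ (i + 1) : ℕ) : ℝ) * β ^ i) = ((δ (i + 1) : ℕ) : ℝ) * β ^ (i + 1) :=
        fun i => by ring
      simp only [this]
      ring
  have hz : Tendsto (fun n => β ^ n * y n) atTop (𝓝 0) := by
    refine squeeze_zero_norm (a := fun n => β ^ n * C) (fun n => ?_) ?_
    · rw [norm_mul, norm_pow, Real.norm_of_nonneg h0.le]
      exact mul_le_mul_of_nonneg_left (hC n) (by positivity)
    · simpa using (tendsto_pow_atTop_nhds_zero_of_lt_one h0.le h1).mul_const C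
  have hlim := (summable_digits h0 h1 ε).hasSum.tendsto_sum_nat.add hz
  rw [add_zero] at hlim
  exact hA.mem_of_tendsto hlim
    (Eventually.of_forall fun n => hmem n 0 ε _ (by simpa using hy n))

/-- A translate of `K_β` inside `K_α` gives an affine embedding of `C_β` into `C_α`. -/
theorem affinelyEmbeds_of_add_mem {α β : ℝ} (hβ0 : 0 < β) (hβ1 : β < 1) (hα0 : 0 < α)
    (hα1 : α < 1) (a : ℝ) (h : ∀ y ∈ digitSums β, y + a ∈ digitSums α) :
    AffinelyEmbeds (centralCantorSet β) (centralCantorSet α) := by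
  have hα : 0 < 1 - α := by linarith
  have hβ : 0 < 1 - β := by linarith
  refine ⟨(1 - α) / (1 - β), (1 - α) * a, by positivity, ?_⟩
  rintro _ ⟨x, hx, rfl⟩
  obtain ⟨y, hy, rfl⟩ := (mem_centralCantorSet_iff hβ0 hβ1).1 hx
  refine (mem_centralCantorSet_iff hα0 hα1).2 ⟨_, h y hy, ?_⟩
  field_simp

/-! ### Construction of embeddings -/

theorem pow_mul_mem_digitSums {α : ℝ} (h0 : 0 < α) (h1 : α < 1) {y : ℝ} (hy : y ∈ digitSums α)
    (n : ℕ) : α ^ n * y ∈ digitSums α := by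
  induction n with
  | zero => simpa using hy
  | succ n ih =>
    have := mul_mem_digitSums h0 h1 ih 0
    convert! this using 1
    simp; ring

theorem affinelyEmbeds_pow {α : ℝ} (h0 : 0 < α) (h1 : α < 1) {n : ℕ} (hn : n ≠ 0) :
    AffinelyEmbeds (centralCantorSet (α ^ n)) (centralCantorSet α) := by
  have hβ0 : 0 < α ^ n := by positivity
  have hβ1 : α ^ n < 1 := pow_lt_one₀ h0.le h1 hn
  refine affinelyEmbeds_of_add_mem hβ0 hβ1 h0 h1 0 fun y hy => ?_
  rw [add_zero]
  refine digitSums_subset_of_step hβ0 hβ1 (fun _ => digitSums α) (isClosed_digitSums h0 h1)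
    (fun _ => 0) (fun _ => zero_mem_digitSums α) 0 (fun _ => by simp) (fun _ k x hx => ?_) hy
  obtain ⟨m, rfl⟩ := Nat.exists_eq_succ_of_ne_zero hn
  convert! mul_mem_digitSums h0 h1 (pow_mul_mem_digitSums h0 h1 hx m) k using 1
  rw [pow_succ]; ring

/-- If `β ^ 2 = α ^ 3` and `β = α - α ^ 2`, then `C_β` embeds into `C_α`: the terms `β ^ (2 k)`
and `β ^ (2 k + 1)` are `α ^ (3 k)` and `α ^ (3 k + 1) - α ^ (3 k + 2)`, whose exponents are all
distinct, and the translation by `∑ α ^ (3 k + 2)` turns the digits `-1` into digits `0`. -/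
theorem affinelyEmbeds_of_sq_eq_cube {α β : ℝ} (hβ0 : 0 < β) (hβ1 : β < 1) (hα0 : 0 < α)
    (hα1 : α < 1) (h23 : β ^ 2 = α ^ 3) (hβ : β = α - α ^ 2) :
    AffinelyEmbeds (centralCantorSet β) (centralCantorSet α) := by
  have h3 : 0 < 1 - α ^ 3 := by have := pow_lt_one₀ hα0.le hα1 three_ne_zero; linarith
  set a : ℝ := α ^ 2 / (1 - α ^ 3) with ha
  have haeq : a = α ^ 2 + α ^ 3 * a := by rw [ha]; field_simp; ring
  have haK : a ∈ digitSums α := by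
    refine (digitSums_subset_of_step (β := α ^ 3) (by positivity)
      (pow_lt_one₀ hα0.le hα1 three_ne_zero) (fun _ => {x | α ^ 2 * x ∈ digitSums α})
      ((isClosed_digitSums hα0 hα1).preimage (by fun_prop)) (fun _ => 0)
      (fun _ => by simpa using zero_mem_digitSums α) 0 (fun _ => by simp) ?_)
      ⟨fun _ => 1, (?_ : _ = (1 - α ^ 3)⁻¹)⟩
    · intro _ k x hx
      have := pow_mul_mem_digitSums hα0 hα1
        (mul_mem_digitSums hα0 hα1 (show α ^ 2 * x ∈ digitSums α from hx) k) 2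
      rw [Set.mem_ofPred_eq]
      convert! this using 1
      ring
    · simpa using tsum_geometric_of_lt_one (by positivity) (pow_lt_one₀ hα0.le hα1 three_ne_zero)
  -- `A 0` are the admissible points, `A 1` the points admissible for the tail of odd index.
  let A : ℕ → Set ℝ := fun n => if Even n then {x | x + a ∈ digitSums α}
    else {x | ∃ z ∈ digitSums α, β * x + a = α * z}
  refine affinelyEmbeds_of_add_mem hβ0 hβ1 hα0 hα1 a fun y hy => ?_
  have h0 : (0 : ℝ) + a ∈ digitSums α := by simpa using haK
  have h1 : ∃ z ∈ digitSums α, β * 0 + a = α * z := by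
    refine ⟨α + α ^ 2 * a, ?_, by rw [mul_zero, zero_add]; linarith [haeq]⟩
    have := mul_mem_digitSums hα0 hα1 (mul_mem_digitSums hα0 hα1
      haK 1) 0
    convert! this using 1
    simp; ring
  have key : digitSums β ⊆ A 0 := by
    refine digitSums_subset_of_step hβ0 hβ1 A ?_ (fun _ => 0) ?_ 0 (fun _ => by simp) ?_
    · have e0 : A 0 = (fun x => x + a) ⁻¹' digitSums α := by ext; simp [A]
      rw [e0]
      exact (isClosed_digitSums hα0 hα1).preimage (by fun_prop)
    · intro n
      by_cases hn : Even n
      · simpa [A, hn] using h0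
      · simpa [A, hn] using h1
    · intro n k x hx
      by_cases hn : Even n
      · have hn' : ¬ Even (n + 1) := by simpa [Nat.even_add_one] using hn
        simp only [A, hn', if_false, Set.mem_ofPred_eq] at hx
        obtain ⟨z, hz, hxz⟩ := hx
        simp only [A, hn, if_true, Set.mem_ofPred_eq]
        convert! mul_mem_digitSums hα0 hα1 hz k using 1
        linarith
      · have hn' : Even (n + 1) := by simpa [Nat.even_add_one] using hn
        simp only [A, hn', if_true, Set.mem_ofPred_eq] at hx
        simp only [A, hn, if_false, Set.mem_ofPred_eq]
        refine ⟨((k : ℕ) : ℝ) + α * ((((1 - k : Fin 2)) : ℕ) + α * (x + a)),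
          mul_mem_digitSums hα0 hα1 (mul_mem_digitSums hα0 hα1 hx _) _, ?_⟩
        have e : β * (((k : ℕ) : ℝ) + β * x) = ((k : ℕ) : ℝ) * (α - α ^ 2) + α ^ 3 * x := by
          rw [mul_add, ← mul_assoc, ← pow_two, h23]; rw [hβ]; ring
        rw [e]
        nth_rewrite 1 [haeq]
        fin_cases k <;> simp <;> ring
  simpa [A] using key hy

/-- With `γ = (√5 - 1) / 2` the pair `α = γ ^ 2`, `β = γ ^ 3` satisfies `β = α - α ^ 2`, because
`γ ^ 2 = 1 - γ`. -/
theorem exists_affinelyEmbeds_of_not_nat :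
    ∃ α β : ℝ, 0 < β ∧ β < α ∧ 1 / 4 ≤ α ∧ α < √2 - 1 ∧
      AffinelyEmbeds (centralCantorSet β) (centralCantorSet α) ∧
        ¬ ∃ n : ℕ, Real.log β / Real.log α = (n : ℝ) := by
  set γ : ℝ := (√5 - 1) / 2 with hγ
  have h5 : √5 ^ 2 = 5 := Real.sq_sqrt (by norm_num)
  have hγ2 : γ ^ 2 = 1 - γ := by rw [hγ]; linarith
  have hl : 2.236 < √5 := Real.lt_sqrt_of_sq_lt (by norm_num)
  have hu : √5 < 2.237 := by
    rw [Real.sqrt_lt' (by norm_num)]; norm_num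
  have h2 : 1.414 < √2 := Real.lt_sqrt_of_sq_lt (by norm_num)
  have g0 : 0.618 ≤ γ := by rw [hγ]; linarith
  have g1 : γ ≤ 0.6185 := by rw [hγ]; linarith
  have g00 : 0 < γ := by linarith
  have e3 : γ ^ 3 = 2 * γ - 1 := by
    have : γ ^ 3 = γ * γ ^ 2 := by ring
    rw [this, hγ2]; linarith [hγ2]
  refine ⟨γ ^ 2, γ ^ 3, by positivity, by linarith, by linarith, by linarith,
    affinelyEmbeds_of_sq_eq_cube (by positivity) (by linarith) (by positivity) (by linarith)
      (by ring) ?_, ?_⟩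
  · have : (γ ^ 2) ^ 2 = (1 - γ) ^ 2 := by rw [hγ2]
    rw [this, e3, hγ2]; nlinarith
  · rintro ⟨n, hn⟩
    have hlog : Real.log γ ≠ 0 := (Real.log_neg g00 (by linarith)).ne
    rw [Real.log_pow, Real.log_pow, div_eq_iff (by simpa using hlog)] at hn
    have : (3 : ℝ) = n * 2 := by
      apply mul_right_cancel₀ hlog
      push_cast at hn
      linarith
    have : (3 : ℕ) = n * 2 := by exact_mod_cast this
    omega

/-! ### Commensurability through gaps -/

/-- A rotation orbit that stays in an arc shorter than half of the circle is constant. -/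
theorem exists_int_eq_of_orbit_mem_arc {τ b lo hi : ℝ} (hlen : hi - lo < 1 / 2) (s : ℕ → ℤ)
    (h : ∀ n : ℕ, lo ≤ n * τ + b - s n ∧ n * τ + b - s n ≤ hi) : ∃ k : ℤ, τ = k := by
  refine ⟨s 1 - s 0, ?_⟩
  have hk : ∀ n, s (n + 1) - s n = s 1 - s 0 := by
    intro n
    have h0 := h 0
    have h1 := h 1
    have h2 := h n
    have h3 := h (n + 1)
    push_cast at h0 h1 h3
    have e1 : ((s (n + 1) - s n - (s 1 - s 0) : ℤ) : ℝ) < 1 := by push_cast; linarith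
    have e2 : (-1 : ℝ) < ((s (n + 1) - s n - (s 1 - s 0) : ℤ) : ℝ) := by push_cast; linarith
    have e1' : s (n + 1) - s n - (s 1 - s 0) < 1 := by exact_mod_cast e1
    have e2' : -1 < s (n + 1) - s n - (s 1 - s 0) := by exact_mod_cast e2
    omega
  have hs : ∀ n : ℕ, s n = s 0 + n * (s 1 - s 0) := by
    intro n
    induction n with
    | zero => simp
    | succ n ih =>
      have := hk n
      push_cast
      linarith
  by_contra hne
  have hpos : 0 < |τ - (s 1 - s 0 : ℤ)| := abs_pos.2 (sub_ne_zero.2 hne)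
  obtain ⟨n, hn⟩ := exists_nat_gt (1 / |τ - (s 1 - s 0 : ℤ)|)
  rw [div_lt_iff₀ hpos] at hn
  have h0 := h 0
  have h1 := h n
  rw [hs n] at h1
  push_cast at h0 h1 hn
  have : (n : ℝ) * |τ - (s 1 - s 0)| = |n * (τ - (s 1 - s 0))| := by
    rw [abs_mul, Nat.abs_cast]
  rw [this, lt_abs] at hn
  rcases hn with hn | hn <;> linarith

/-- Distances in `K_α`: if the digits of `x` and `y` first differ at place `s`, then `x - y` is
comparable to `α ^ s`. -/
theorem exists_pow_le_sub_le {α : ℝ} (h0 : 0 < α) (h1 : α < 1 / 2) {x y : ℝ}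
    (hx : x ∈ digitSums α) (hy : y ∈ digitSums α) (hxy : 0 < x - y) :
    ∃ s : ℕ, α ^ s * ((1 - 2 * α) / (1 - α)) ≤ x - y ∧ x - y ≤ α ^ s * (1 - α)⁻¹ := by
  have hα : α < 1 := by linarith
  have h1' : 0 < 1 - α := by linarith
  have hmul : α * (1 - α)⁻¹ < 1 := by rw [← div_eq_mul_inv, div_lt_one h1']; linarith
  have e : (1 - 2 * α) / (1 - α) = 1 - α * (1 - α)⁻¹ := by field_simp; ring
  obtain ⟨n, hn⟩ := exists_pow_lt_of_lt_one hxy hα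
  replace hn := hn.le
  clear hxy
  induction n generalizing x y with
  | zero =>
    obtain ⟨x', hx', hx⟩ := digitSums_step h0 hα hx
    obtain ⟨y', hy', hy⟩ := digitSums_step h0 hα hy
    have a1 := digitSums_le h0 hα hx'
    have a2 := digitSums_nonneg h0 hx'
    have a3 := digitSums_le h0 hα hy'
    have a4 := digitSums_nonneg h0 hy'
    have b1 := mul_le_mul_of_nonneg_left a1 h0.le
    have b3 := mul_le_mul_of_nonneg_left a3 h0.le
    have b2 := mul_nonneg h0.le a2
    have b4 := mul_nonneg h0.le a4
    have e2 : (1 - α)⁻¹ = 1 + α * (1 - α)⁻¹ := by field_simp; ring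
    refine ⟨0, ?_⟩
    rw [pow_zero] at hn
    rw [pow_zero, one_mul, one_mul, e]
    rcases hx with hx | hx <;> rcases hy with hy | hy <;> constructor <;> linarith
  | succ n ih =>
    obtain ⟨x', hx', hx''⟩ := digitSums_step h0 hα hx
    obtain ⟨y', hy', hy''⟩ := digitSums_step h0 hα hy
    have a1 := digitSums_le h0 hα hx'
    have a2 := digitSums_nonneg h0 hx'
    have a3 := digitSums_le h0 hα hy'
    have a4 := digitSums_nonneg h0 hy'
    have b1 := mul_le_mul_of_nonneg_left a1 h0.le
    have b3 := mul_le_mul_of_nonneg_left a3 h0.le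
    have b2 := mul_nonneg h0.le a2
    have b4 := mul_nonneg h0.le a4
    have hp : 0 < α ^ (n + 1) := by positivity
    have same : x - y = α * (x' - y') →
        ∃ s : ℕ, α ^ s * ((1 - 2 * α) / (1 - α)) ≤ x - y ∧ x - y ≤ α ^ s * (1 - α)⁻¹ := by
      intro hs
      have : α ^ n ≤ x' - y' := by
        rw [hs, pow_succ, mul_comm] at hn
        exact le_of_mul_le_mul_left hn h0
      obtain ⟨s, hs1, hs2⟩ := ih hx' hy' this
      refine ⟨s + 1, ?_⟩
      have c1 := mul_le_mul_of_nonneg_left hs1 h0.le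
      have c2 := mul_le_mul_of_nonneg_left hs2 h0.le
      rw [hs, pow_succ]
      constructor
      · linarith
      · linarith
    rcases hx'' with hx'' | hx'' <;> rcases hy'' with hy'' | hy''
    · exact same (by linarith)
    · linarith
    · refine ⟨0, ?_⟩
      have e2 : (1 - α)⁻¹ = 1 + α * (1 - α)⁻¹ := by field_simp; ring
      rw [pow_zero, one_mul, one_mul, e]
      constructor <;> linarith
    · exact same (by linarith)

/-- For `α < 1 / 4` only integral ratios occur: the differences `c β ^ n` lie in
`⋃ s, α ^ s [(1 - 2 α) / (1 - α), 1 / (1 - α)]`, which has large gaps in logarithmic scale. -/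
theorem exists_nat_of_affinelyEmbeds {α β : ℝ} (hβ0 : 0 < β) (hβα : β < α) (hα : α < 1 / 4)
    (h : AffinelyEmbeds (centralCantorSet β) (centralCantorSet α)) :
    ∃ n : ℕ, Real.log β / Real.log α = (n : ℝ) := by
  have hα0 : 0 < α := hβ0.trans hβα
  obtain ⟨x, c, hc, hK⟩ :=
    exists_finsum_mem_of_affinelyEmbeds hβ0 (by linarith) hα0 (by linarith) h
  have hs : ∀ n : ℕ, ∃ s : ℕ, α ^ s * ((1 - 2 * α) / (1 - α)) ≤ c * β ^ n ∧
      c * β ^ n ≤ α ^ s * (1 - α)⁻¹ := by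
    intro n
    have := exists_pow_le_sub_le hα0 (by linarith) (hK {n}) (hK ∅)
    simp only [Finset.sum_singleton, Finset.sum_empty, mul_zero, add_zero,
      add_sub_cancel_left] at this
    exact this (by positivity)
  choose s hs using hs
  set l := Real.log α with hl
  have hl0 : l < 0 := Real.log_neg hα0 (by linarith)
  have p1 : 0 < 1 - 2 * α := by linarith
  have p2 : 0 < 1 - α := by linarith
  have hτ : 0 < Real.log β / l := div_pos_of_neg_of_neg (Real.log_neg hβ0 (by linarith)) hl0
  -- The arc has length `log (1 - 2 α) / log α`, and `√α < 1 / 2 < 1 - 2 α`.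
  have hlen : Real.log ((1 - 2 * α) / (1 - α)) / l - Real.log (1 - α)⁻¹ / l < 1 / 2 := by
    rw [← sub_div, Real.log_div p1.ne' p2.ne', Real.log_inv, div_lt_iff_of_neg hl0]
    have : l < Real.log ((1 - 2 * α) ^ 2) := by
      refine Real.log_lt_log hα0 ?_
      nlinarith
    rw [Real.log_pow] at this
    push_cast at this
    linarith
  obtain ⟨k, hk⟩ := exists_int_eq_of_orbit_mem_arc (τ := Real.log β / l) (b := Real.log c / l)
    hlen (fun n => (s n : ℤ)) (by
      intro n
      obtain ⟨h1, h2⟩ := hs n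
      have q1 := Real.log_le_log (by positivity) h1
      have q2 := Real.log_le_log (by positivity) h2
      rw [Real.log_mul (by positivity) (by positivity), Real.log_mul hc.ne' (by positivity),
        Real.log_pow, Real.log_pow] at q1
      rw [Real.log_mul hc.ne' (by positivity), Real.log_mul (by positivity) (by positivity),
        Real.log_pow, Real.log_pow] at q2
      have e : (n : ℝ) * (Real.log β / l) + Real.log c / l - ((s n : ℤ) : ℝ) =
          (Real.log c + n * Real.log β - s n * l) / l := by
        push_cast
        field_simp [hl0.ne]
        ring
      rw [e]
      constructor
      · rw [div_le_div_right_of_neg hl0]; linarith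
      · rw [div_le_div_right_of_neg hl0]; linarith)
  have : 0 < k := by rw [hk] at hτ; exact_mod_cast hτ
  refine ⟨k.toNat, ?_⟩
  rw [hk]
  exact_mod_cast (Int.toNat_of_nonneg this.le).symm

/-! ### Density of the quotients of powers -/

/-- If `log β / log α` is irrational, then the numbers `c β ^ n / α ^ k` with large `n` and `k`
are dense in `(0, ∞)`. -/
theorem exists_pow_mul_mem_Ioo {α β c v w : ℝ} (hα0 : 0 < α) (hα1 : α < 1) (hβ0 : 0 < β)
    (hβ1 : β < 1) (hirr : Irrational (Real.log β / Real.log α)) (hc : 0 < c) (hv : 0 < v)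
    (hvw : v < w) (m : ℕ) :
    ∃ n k : ℕ, m ≤ n ∧ m ≤ k ∧ α ^ k * v < c * β ^ n ∧ c * β ^ n < α ^ k * w := by
  set l := Real.log α with hl
  have hl0 : l < 0 := Real.log_neg hα0 hα1
  -- `n ≥ m₁` forces `c β ^ n < α ^ m v`, so that `k ≥ m` in the end.
  obtain ⟨m₁, hm₁⟩ := exists_pow_lt_of_lt_one (show 0 < α ^ m * v / c by positivity) hβ1
  set M := max m m₁ with hM
  have hdense : DenseRange (fun n : ℕ => n • ((Real.log β / l : ℝ) : AddCircle (1 : ℝ))) := by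
    rw [← denseRange_zsmul_iff_nsmul]
    exact AddCircle.denseRange_zsmul_coe_iff.2 (by simpa using hirr)
  have hV : IsOpen (((↑) : ℝ → AddCircle (1 : ℝ)) '' Set.Ioo
      ((Real.log w - Real.log c - M * Real.log β) / l)
      ((Real.log v - Real.log c - M * Real.log β) / l)) :=
    QuotientAddGroup.isOpenMap_coe _ isOpen_Ioo
  have hlog : Real.log v < Real.log w := Real.log_lt_log hv hvw
  obtain ⟨n, ⟨t, ⟨ht1, ht2⟩, htn⟩⟩ := hdense.exists_mem_open hV
    (Set.Nonempty.image _ (Set.nonempty_Ioo.2 (by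
      rw [div_lt_div_right_of_neg hl0]; linarith)))
  have : ((t : ℝ) : AddCircle (1 : ℝ)) = ((n * (Real.log β / l) : ℝ) : AddCircle (1 : ℝ)) := by
    rw [htn, ← nsmul_eq_mul]; rfl
  obtain ⟨j, hj⟩ : ∃ j : ℤ, t = n * (Real.log β / l) - j := by
    rw [← sub_eq_zero, ← AddCircle.coe_sub, AddCircle.coe_eq_zero_iff] at this
    obtain ⟨j, hj⟩ := this
    exact ⟨-j, by simp at hj; push_cast; linarith⟩
  have hsum : Real.log (c * β ^ (M + n)) = Real.log c + M * Real.log β + n * Real.log β := by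
    rw [Real.log_mul hc.ne' (by positivity), Real.log_pow]; push_cast; ring
  have ht : t * l = n * Real.log β - j * l := by rw [hj]; field_simp [hl0.ne]
  rw [div_lt_iff_of_neg hl0, ht] at ht1
  rw [lt_div_iff_of_neg hl0, ht] at ht2
  have hjm : (m : ℤ) ≤ j := by
    have h1 : c * β ^ (M + n) < α ^ m * v := by
      have : β ^ (M + n) ≤ β ^ m₁ := pow_le_pow_of_le_one hβ0.le hβ1.le (by omega)
      rw [lt_div_iff₀ hc] at hm₁
      nlinarith
    have h2 := Real.log_lt_log (by positivity) h1
    rw [hsum, Real.log_mul (by positivity) hv.ne', Real.log_pow] at h2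
    have h3 : (j : ℝ) * l < m * l := by linarith
    have h4 : (m : ℝ) < j := lt_of_mul_lt_mul_of_nonpos_right h3 hl0.le
    exact_mod_cast h4.le
  lift j to ℕ using by omega
  push_cast at ht1 ht2
  refine ⟨M + n, j, by omega, by exact_mod_cast hjm, ?_, ?_⟩
  · rw [← Real.log_lt_log_iff (by positivity) (by positivity), hsum,
      Real.log_mul (by positivity) hv.ne', Real.log_pow]
    linarith
  · rw [← Real.log_lt_log_iff (by positivity) (by have := hv.trans hvw; positivity), hsum,
      Real.log_mul (by positivity) (hv.trans hvw).ne', Real.log_pow]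
    linarith

/-! ### A difference with a unique digit expansion -/

theorem exists_same_digit {α : ℝ} (h0 : 0 < α) (h1 : α < 1) {d x y : ℝ} (hd : d = 0 ∨ d = 1)
    (hx : x ∈ digitSums α) (hy : y ∈ digitSums α)
    (hxy : |y - (d + α * x)| < 1 - α * (1 - α)⁻¹) : ∃ z ∈ digitSums α, y = d + α * z := by
  obtain ⟨z, hz, hyz⟩ := digitSums_step h0 h1 hy
  have b1 := mul_le_mul_of_nonneg_left (digitSums_le h0 h1 hx) h0.le
  have b3 := mul_le_mul_of_nonneg_left (digitSums_le h0 h1 hz) h0.le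
  have b2 := mul_nonneg h0.le (digitSums_nonneg h0 hx)
  have b4 := mul_nonneg h0.le (digitSums_nonneg h0 hz)
  rw [abs_lt] at hxy
  refine ⟨z, hz, ?_⟩
  rcases hd with rfl | rfl <;> rcases hyz with h | h <;> linarith

/-- A parallelogram in `K_α` whose sides are short compared with the gaps of level less than `k`
lies in a single cylinder of level `k`, which can be blown up. -/
theorem exists_parallelogram_of_pow_mul {α : ℝ} (h0 : 0 < α) (h1 : α < 1) {u v : ℝ} (hv : 0 ≤ v)
    (hvu : v ≤ u) (hu : α * u < 1 - α * (1 - α)⁻¹) (k : ℕ) {x : ℝ} (hx : x ∈ digitSums α)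
    (hxv : x + α ^ k * v ∈ digitSums α) (hxu : x + α ^ k * u ∈ digitSums α)
    (hxuv : x + α ^ k * v + α ^ k * u ∈ digitSums α) :
    ∃ x ∈ digitSums α, x + v ∈ digitSums α ∧ x + u ∈ digitSums α ∧
      x + v + u ∈ digitSums α := by
  induction k generalizing x with
  | zero => exact ⟨x, hx, by simpa using hxv, by simpa using hxu, by simpa using hxuv⟩
  | succ k ih =>
    have small : ∀ w, 0 ≤ w → w ≤ u → ∀ z : ℝ, |z + α ^ (k + 1) * w - z| < 1 - α * (1 - α)⁻¹ := by
      intro w hw hwu z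
      have e : z + α ^ (k + 1) * w - z = α ^ k * (α * w) := by ring
      rw [e, abs_of_nonneg (by positivity)]
      refine lt_of_le_of_lt ?_ hu
      calc α ^ k * (α * w) ≤ 1 * (α * w) :=
            mul_le_mul_of_nonneg_right (pow_le_one₀ h0.le h1.le) (by positivity)
        _ ≤ α * u := by rw [one_mul]; exact mul_le_mul_of_nonneg_left hwu h0.le
    obtain ⟨d, hd, x₁, hx₁, rfl⟩ : ∃ d : ℝ, (d = 0 ∨ d = 1) ∧ ∃ x₁ ∈ digitSums α,
        x = d + α * x₁ := by
      obtain ⟨x₁, hx₁, h | h⟩ := digitSums_step h0 h1 hx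
      · exact ⟨0, Or.inl rfl, x₁, hx₁, by linarith⟩
      · exact ⟨1, Or.inr rfl, x₁, hx₁, h⟩
    obtain ⟨x₂, hx₂, e₂⟩ := exists_same_digit h0 h1 hd hx₁ hxv (small v hv hvu _)
    obtain ⟨x₃, hx₃, e₃⟩ := exists_same_digit h0 h1 hd hx₁ hxu (small u (hv.trans hvu) le_rfl _)
    obtain ⟨x₄, hx₄, e₄⟩ := exists_same_digit h0 h1 hd hx₂ hxuv (by
      rw [← e₂]; exact small u (hv.trans hvu) le_rfl _)
    have f : ∀ {w p q : ℝ}, α ^ (k + 1) * w = α * q - α * p → q = p + α ^ k * w := by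
      intro w p q h
      have : α * (α ^ k * w) = α * (q - p) := by rw [mul_sub, ← h]; ring
      linarith [mul_left_cancel₀ h0.ne' this]
    have f₂ : x₂ = x₁ + α ^ k * v := f (by linarith)
    have f₃ : x₃ = x₁ + α ^ k * u := f (by linarith)
    have f₄ : x₄ = x₂ + α ^ k * u := f (by linarith)
    exact ih hx₁ (f₂ ▸ hx₂) (f₃ ▸ hx₃) (by rw [← f₂, ← f₄]; exact hx₄)

/-- The number `1 / (1 + α) = ∑ (-α) ^ i` is a difference of two points of `K_α` in only one way,
and stably so: the digits of `x` and `y` begin with `0, 1, 0, 1, …` and `1, 0, 1, 0, …` as soon as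
`y - x` is close to it. The limit points are `α / (1 - α ^ 2)` and `1 / (1 - α ^ 2)`. -/
theorem abs_sub_le_of_sub_close {α η : ℝ} (h0 : 0 < α) (h1 : α < 1)
    (hη : η ≤ (1 + α)⁻¹ - α * (1 - α)⁻¹) (N : ℕ) {x y : ℝ} (hx : x ∈ digitSums α)
    (hy : y ∈ digitSums α) (hxy : |y - x - (1 + α)⁻¹| < η * α ^ N) :
    |x - α / (1 - α ^ 2)| ≤ α ^ N * (1 - α)⁻¹ ∧ |y - 1 / (1 - α ^ 2)| ≤ α ^ N * (1 - α)⁻¹ := by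
  have h1' : 0 < 1 - α := by linarith
  have h1p : 0 < 1 + α := by linarith
  have h2 : 0 < 1 - α ^ 2 := by nlinarith
  induction N generalizing x y with
  | zero =>
    have a1 := digitSums_le h0 h1 hx
    have a2 := digitSums_nonneg h0 hx
    have a3 := digitSums_le h0 h1 hy
    have a4 := digitSums_nonneg h0 hy
    have e1 : α / (1 - α ^ 2) ≤ (1 - α)⁻¹ := by
      rw [← one_div, div_le_div_iff₀ h2 h1']; nlinarith
    have e2 : 1 / (1 - α ^ 2) ≤ (1 - α)⁻¹ := by
      rw [← one_div, div_le_div_iff₀ h2 h1']; nlinarith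
    have e3 : 0 ≤ α / (1 - α ^ 2) := by positivity
    have e4 : 0 ≤ 1 / (1 - α ^ 2) := by positivity
    rw [pow_zero, one_mul, abs_le, abs_le]
    refine ⟨⟨?_, ?_⟩, ?_, ?_⟩ <;> linarith
  | succ N ih =>
    obtain ⟨x', hx', hx''⟩ := digitSums_step h0 h1 hx
    obtain ⟨y', hy', hy''⟩ := digitSums_step h0 h1 hy
    have b1 := mul_le_mul_of_nonneg_left (digitSums_le h0 h1 hx') h0.le
    have b3 := mul_le_mul_of_nonneg_left (digitSums_le h0 h1 hy') h0.le
    have b2 := mul_nonneg h0.le (digitSums_nonneg h0 hx')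
    have b4 := mul_nonneg h0.le (digitSums_nonneg h0 hy')
    have hη0 : 0 < η := by
      by_contra hneg
      have : η * α ^ (N + 1) ≤ 0 := mul_nonpos_of_nonpos_of_nonneg (not_lt.1 hneg) (by positivity)
      linarith [abs_nonneg (y - x - (1 + α)⁻¹)]
    have hlt : y - x > α * (1 - α)⁻¹ := by
      have : η * α ^ (N + 1) ≤ η := mul_le_of_le_one_right hη0.le (pow_le_one₀ h0.le h1.le)
      linarith [(abs_lt.1 hxy).1]
    have hx3 : x = α * x' ∧ y = 1 + α * y' := by
      rcases hx'' with hx'' | hx'' <;> rcases hy'' with hy'' | hy'' <;>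
        first | exact ⟨hx'', hy''⟩ | linarith
    obtain ⟨rfl, rfl⟩ := hx3
    have e5 : 1 + α * y' - α * x' - (1 + α)⁻¹ = -(α * (x' - y' - (1 + α)⁻¹)) := by
      field_simp; ring
    rw [e5, abs_neg, abs_mul, abs_of_pos h0] at hxy
    obtain ⟨i1, i2⟩ := ih hy' hx' (by
      refine lt_of_mul_lt_mul_left (hxy.trans_eq ?_) h0.le
      ring)
    have e6 : α * x' - α / (1 - α ^ 2) = α * (x' - 1 / (1 - α ^ 2)) := by ring
    have e7 : 1 + α * y' - 1 / (1 - α ^ 2) = α * (y' - α / (1 - α ^ 2)) := by field_simp; ring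
    rw [e6, e7, abs_mul, abs_mul, abs_of_pos h0, pow_succ]
    constructor
    · calc α * |x' - 1 / (1 - α ^ 2)| ≤ α * (α ^ N * (1 - α)⁻¹) :=
            mul_le_mul_of_nonneg_left i2 h0.le
        _ = _ := by ring
    · calc α * |y' - α / (1 - α ^ 2)| ≤ α * (α ^ N * (1 - α)⁻¹) :=
            mul_le_mul_of_nonneg_left i1 h0.le
        _ = _ := by ring

/-- For `α < √2 - 1` the ratio is rational: otherwise some `u = c β ^ n` is so close to
`α ^ k / (1 + α)` that the two points `x` and `x + c β ^ (n + 1)`, both of which can be shifted by `u`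
inside `K_α`, have too many common digits. -/
theorem exists_rat_of_lt_sqrt_two_sub_one {α β : ℝ} (hβ0 : 0 < β) (hβα : β < α)
    (hα : α < √2 - 1) (h : AffinelyEmbeds (centralCantorSet β) (centralCantorSet α)) :
    ∃ q : ℚ, Real.log β / Real.log α = (q : ℝ) := by
  have hα0 : 0 < α := hβ0.trans hβα
  have h2 : α ^ 2 + 2 * α < 1 := by
    have : √2 ^ 2 = 2 := Real.sq_sqrt (by norm_num)
    nlinarith [Real.sqrt_nonneg 2]
  have hα1 : α < 1 / 2 := by nlinarith
  by_contra hq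
  have hirr : Irrational (Real.log β / Real.log α) := fun ⟨q, hq'⟩ => hq ⟨q, hq'.symm⟩
  obtain ⟨x, c, hc, hK⟩ :=
    exists_finsum_mem_of_affinelyEmbeds hβ0 (by linarith) hα0 (by linarith) h
  have p1 : 0 < 1 - α := by linarith
  have p2 : 0 < 1 + α := by linarith
  set t : ℝ := (1 + α)⁻¹ with ht
  set η : ℝ := t - α * (1 - α)⁻¹ with hη
  have ht0 : 0 < t := by positivity
  have e1 : η = (1 - 2 * α - α ^ 2) / ((1 - α) * (1 + α)) := by
    rw [hη, ht]; field_simp; ring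
  have hη0 : 0 < η := by rw [e1]; apply div_pos <;> nlinarith
  have hη1 : α * (t + η) ≤ 1 - α * (1 - α)⁻¹ := by
    have e2 : 1 - α * (1 - α)⁻¹ - α * t = η := by
      rw [hη, ht]; field_simp; ring
    nlinarith
  obtain ⟨N, hN⟩ := exists_pow_lt_of_lt_one (show 0 < β * (t / 2) * (1 - α) / 2 by positivity)
    (show α < 1 by linarith)
  have hηN0 : 0 < η * α ^ N := by positivity
  have hηN1 : η * α ^ N ≤ η := mul_le_of_le_one_right hη0.le (pow_le_one₀ hα0.le (by linarith))
  obtain ⟨n, k, -, -, hnk1, hnk2⟩ := exists_pow_mul_mem_Ioo (v := max (t / 2) (t - η * α ^ N))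
    (w := t + η * α ^ N) hα0 (by linarith) hβ0 (by linarith) hirr hc
    (lt_max_of_lt_left (by linarith)) (max_lt (by linarith) (by linarith)) 0
  have hk0 : 0 < α ^ k := by positivity
  obtain ⟨u, hu⟩ : ∃ u, c * β ^ n = α ^ k * u := ⟨c * β ^ n / α ^ k, by field_simp⟩
  rw [hu] at hnk1 hnk2
  have hu1 := lt_of_mul_lt_mul_left hnk1 hk0.le
  have hu2 := lt_of_mul_lt_mul_left hnk2 hk0.le
  rw [max_lt_iff] at hu1
  have hu0 : 0 < u := by linarith
  have hv : c * β ^ (n + 1) = α ^ k * (β * u) := by rw [pow_succ, ← mul_assoc, hu]; ring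
  obtain ⟨y, hy, hyv, hyu, hyuv⟩ := exists_parallelogram_of_pow_mul hα0 (by linarith)
    (u := u) (v := β * u) (by positivity) (mul_le_of_le_one_left hu0.le (by linarith))
    (lt_of_lt_of_le (by nlinarith) hη1) k (by simpa using hK ∅)
    (by simpa [hv] using hK {n + 1}) (by simpa [hu] using hK {n}) (by
      have := hK {n + 1, n}
      rw [Finset.sum_pair (by omega), mul_add, hv, hu] at this
      rwa [add_assoc])
  have c1 := (abs_sub_le_of_sub_close hα0 (by linarith) hη.le N hy hyu (by
    rw [abs_lt]; constructor <;> linarith)).1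
  have c2 := (abs_sub_le_of_sub_close hα0 (by linarith) hη.le N hyv hyuv (by
    rw [abs_lt]; constructor <;> linarith)).1
  rw [abs_le] at c1 c2
  have c3 : β * u ≤ 2 * (α ^ N * (1 - α)⁻¹) := by linarith
  have c4 : 2 * (α ^ N * (1 - α)⁻¹) < β * (t / 2) := by
    rw [← div_eq_mul_inv, ← mul_div_assoc, div_lt_iff₀ p1]
    linarith
  have c5 : β * (t / 2) < β * u := mul_lt_mul_of_pos_left hu1.1 hβ0
  linarith

/-! ### Integer polynomials with bounded values at the conjugates -/

open Polynomial in
/-- The integer polynomial `P` takes values of absolute value at most `C` at all conjugates of `θ`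
other than `θ`. Elements of `ℤ[θ]` are written as `P(θ)` with an integer polynomial `P`. -/
def ConjBounded (θ C : ℝ) (P : ℤ[X]) : Prop :=
  ∀ z : ℂ, aeval z (minpoly ℚ θ) = 0 → z ≠ (θ : ℂ) → ‖aeval z P‖ ≤ C

namespace ConjBounded

open Polynomial

theorem zero {θ C : ℝ} (hC : 0 ≤ C) : ConjBounded θ C 0 := fun z _ _ => by simpa using hC

theorem sub {θ C C' : ℝ} {P Q : ℤ[X]} (hP : ConjBounded θ C P) (hQ : ConjBounded θ C' Q) :
    ConjBounded θ (C + C') (P - Q) := fun z hz hz' => by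
  rw [map_sub]
  exact (norm_sub_le _ _).trans (add_le_add (hP z hz hz') (hQ z hz hz'))

end ConjBounded

open Polynomial in
theorem IsPisot.exists_conj_norm_le {θ : ℝ} (hθ : IsPisot θ) :
    ∃ r : ℝ, 0 ≤ r ∧ r < 1 ∧
      ∀ z : ℂ, aeval z (minpoly ℚ θ) = 0 → z ≠ (θ : ℂ) → ‖z‖ ≤ r := by
  have hne : minpoly ℚ θ ≠ 0 := minpoly.ne_zero hθ.1.tower_top
  set s : Set ℂ := {z | aeval z (minpoly ℚ θ) = 0 ∧ z ≠ (θ : ℂ)} with hs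
  have hfin : s.Finite := ((minpoly ℚ θ).rootSet_finite ℂ).subset fun z hz =>
    (mem_rootSet.2 ⟨hne, hz.1⟩)
  rcases s.eq_empty_or_nonempty with he | hn
  · refine ⟨0, le_rfl, one_pos, fun z hz hz' => ?_⟩
    have : z ∈ s := ⟨hz, hz'⟩
    simp [he] at this
  · obtain ⟨z₀, hz₀, hmax⟩ := Set.exists_max_image s (fun z => ‖z‖) hfin hn
    exact ⟨‖z₀‖, norm_nonneg _, hθ.2.2 z₀ hz₀.1 hz₀.2, fun z hz hz' => hmax z ⟨hz, hz'⟩⟩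

open Polynomial IntermediateField in
theorem finite_conjBounded_values {θ : ℝ} (hθ : IsIntegral ℤ θ) (B C : ℝ) :
    {v : ℝ | |v| ≤ B ∧ ∃ P : ℤ[X], v = aeval θ P ∧ ConjBounded θ C P}.Finite := by
  have hθQ : IsIntegral ℚ θ := hθ.tower_top
  have : FiniteDimensional ℚ ℚ⟮θ⟯ := adjoin.finiteDimensional hθQ
  have : NumberField ℚ⟮θ⟯ := {}
  refine ((NumberField.Embeddings.finite_of_norm_le ℚ⟮θ⟯ ℂ (max B C)).image
    (algebraMap ℚ⟮θ⟯ ℝ)).subset ?_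
  rintro v ⟨hv, P, rfl, hP⟩
  have hgen : IsIntegral ℤ (AdjoinSimple.gen ℚ θ) := by
    rw [← isIntegral_algebraMap_iff (algebraMap ℚ⟮θ⟯ ℝ).injective,
      AdjoinSimple.algebraMap_gen]
    exact hθ
  refine ⟨aeval (AdjoinSimple.gen ℚ θ) P, ⟨?_, fun φ => ?_⟩, ?_⟩
  · exact IsIntegral.of_mem_of_fg _ hgen.fg_adjoin_singleton _ (aeval_mem_adjoin_singleton _ _)
  · have e : φ (aeval (AdjoinSimple.gen ℚ θ) P) = aeval (φ (AdjoinSimple.gen ℚ θ)) P := by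
      rw [← φ.toIntAlgHom_apply, ← φ.toIntAlgHom_apply, aeval_algHom_apply]
    rw [e]
    by_cases hz : φ (AdjoinSimple.gen ℚ θ) = (θ : ℂ)
    · rw [hz]
      have : aeval (θ : ℂ) P = ((aeval θ P : ℝ) : ℂ) := by
        rw [← Complex.coe_algebraMap, aeval_algebraMap_apply]
      rw [this, Complex.norm_real]
      exact hv.trans (le_max_left _ _)
    · refine (hP _ ?_ hz).trans (le_max_right _ _)
      have h := congrArg φ (aeval_gen_minpoly ℚ θ)
      rwa [map_zero, aeval_def, hom_eval₂, RingHom.ext_rat (φ.comp _) (algebraMap ℚ ℂ),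
        ← aeval_def] at h
  · rw [← aeval_algebraMap_apply, AdjoinSimple.algebraMap_gen]

/-! ### Blown-up Cantor sets are thin near the lattice of small conjugates -/

open Polynomial in
/-- The blow-up `θ ^ N K_α` lies within bounded distance of the elements of `ℤ[θ]` whose
conjugates are bounded independently of `N`. -/
theorem exists_level_polynomial {α r : ℝ} (h0 : 0 < α) (h1 : α < 1) (hr0 : 0 ≤ r) (hr1 : r < 1)
    (hr : ∀ z : ℂ, aeval z (minpoly ℚ (1 / α)) = 0 → z ≠ ((1 / α : ℝ) : ℂ) → ‖z‖ ≤ r) {x : ℝ}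
    (hx : x ∈ digitSums α) (N : ℕ) :
    ∃ P : ℤ[X], ∃ y ∈ digitSums α, (1 / α) ^ N * x = aeval (1 / α) P + y ∧
      ConjBounded (1 / α) (r / (1 - r)) P := by
  have hr' : 0 < 1 - r := by linarith
  induction N with
  | zero => exact ⟨0, x, hx, by simp, ConjBounded.zero (by positivity)⟩
  | succ N ih =>
    obtain ⟨P, y, hy, e, hP⟩ := ih
    obtain ⟨y', hy', hyy⟩ := digitSums_step h0 h1 hy
    obtain ⟨d, hd, hyd⟩ : ∃ d : ℤ, (d = 0 ∨ d = 1) ∧ y = d + α * y' := by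
      rcases hyy with h | h
      · exact ⟨0, Or.inl rfl, by simpa using h⟩
      · exact ⟨1, Or.inr rfl, by simpa using h⟩
    refine ⟨X * (P + C d), y', hy', ?_, fun z hz hz' => ?_⟩
    · rw [pow_succ', mul_assoc, e, hyd]
      simp
      field_simp
      ring
    · have hd1 : ‖(d : ℂ)‖ ≤ 1 := by rcases hd with rfl | rfl <;> simp
      have : aeval z (X * (P + C d)) = z * (aeval z P + d) := by simp
      rw [this, norm_mul]
      calc ‖z‖ * ‖aeval z P + d‖ ≤ r * (r / (1 - r) + 1) :=
            mul_le_mul (hr z hz hz') ((norm_add_le _ _).trans (add_le_add (hP z hz hz') hd1))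
              (norm_nonneg _) hr0
        _ = r / (1 - r) := by field_simp; ring

/-- The first `k` digits of a point of `K_α` are read off from `(1 / α) ^ k x`, and take at most
`2 ^ k` values. -/
theorem exists_finset_level {α : ℝ} (h0 : 0 < α) (h1 : α < 1) (k : ℕ) :
    ∃ D : Finset ℝ, D.card ≤ 2 ^ k ∧
      ∀ x ∈ digitSums α, ∃ d ∈ D, ∃ y ∈ digitSums α, (1 / α) ^ k * x = d + y := by
  classical
  induction k with
  | zero => exact ⟨{0}, by simp, fun x hx => ⟨0, by simp, x, hx, by simp⟩⟩
  | succ k ih =>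
    obtain ⟨D, hD, h⟩ := ih
    refine ⟨D.image (fun d => 1 / α * d) ∪ D.image (fun d => 1 / α * (d + 1)), ?_, ?_⟩
    · refine (Finset.card_union_le _ _).trans ?_
      have a := Finset.card_image_le (s := D) (f := fun d => 1 / α * d)
      have b := Finset.card_image_le (s := D) (f := fun d => 1 / α * (d + 1))
      rw [pow_succ]; omega
    · intro x hx
      obtain ⟨d, hd, y, hy, e⟩ := h x hx
      obtain ⟨y', hy', hyy⟩ := digitSums_step h0 h1 hy
      rw [pow_succ', mul_assoc, e]
      rcases hyy with rfl | rfl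
      · refine ⟨1 / α * d, Finset.mem_union_left _ (Finset.mem_image_of_mem _ hd), y', hy', ?_⟩
        field_simp
      · refine ⟨1 / α * (d + 1), Finset.mem_union_right _ (Finset.mem_image_of_mem _ hd), y', hy',
          ?_⟩
        field_simp; ring

open Polynomial in
/-- If `θ = 1 / α` is a Pisot number, the differences of points of a blow-up of `K_α`, based at a
common point, cannot come close to all of the cosets `6 j + θ ^ k Λ`, where `Λ` is the set of
elements of `ℤ[θ]` whose other conjugates are at most `C`. Up to bounded errors the difference in
the `j`-th coset determines `j` through its last `k` digits, for which there are `2 ^ k`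
possibilities, and one of boundedly many elements of `ℤ[θ]`; but there are `θ ^ k / 6` cosets. -/
theorem exists_coset_avoided {α : ℝ} (h0 : 0 < α) (h1 : α < 1 / 2) (hθ : IsPisot (1 / α))
    (C : ℝ) :
    ∃ k J : ℕ, ∀ (N : ℕ), ∀ x ∈ digitSums α, ¬ ∀ j < J, ∃ y ∈ digitSums α, ∃ w : ℤ[X],
      ConjBounded (1 / α) C w ∧
        |(1 / α) ^ (N + k) * (y - x) - 6 * j - (1 / α) ^ k * aeval (1 / α) w| < 1 := by
  have h1' : α < 1 := by linarith
  set θ := 1 / α with hθd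
  have hθ2 : 2 < θ := by rw [hθd, lt_div_iff₀ h0]; linarith
  obtain ⟨r, hr0, hr1, hr⟩ := hθ.exists_conj_norm_le
  set W := (finite_conjBounded_values hθ.1 4 (r / (1 - r) + r / (1 - r) + C)).toFinset with hW
  obtain ⟨k, hk⟩ : ∃ k : ℕ, (6 * (W.card + 1) : ℝ) < (θ / 2) ^ k :=
    pow_unbounded_of_one_lt _ (by linarith)
  have hkJ : (6 * (W.card * 2 ^ k + 1 : ℕ) : ℝ) ≤ θ ^ k := by
    rw [div_pow, lt_div_iff₀ (by positivity)] at hk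
    have : (1 : ℝ) ≤ 2 ^ k := one_le_pow₀ (by norm_num)
    push_cast
    nlinarith
  refine ⟨k, W.card * 2 ^ k + 1, fun N x hx hall => ?_⟩
  have hθk : 1 ≤ θ ^ k := one_le_pow₀ (by linarith)
  have K2 : ∀ y ∈ digitSums α, 0 ≤ y ∧ y ≤ 2 := fun y hy => by
    refine ⟨digitSums_nonneg h0 hy, (digitSums_le h0 h1' hy).trans ?_⟩
    rw [inv_le_comm₀ (by linarith) (by norm_num)]; linarith
  obtain ⟨D, hD, hDm⟩ := exists_finset_level h0 h1' k
  obtain ⟨P, x', hx', ex, hP⟩ := exists_level_polynomial h0 h1' hr0 hr1 hr hx N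
  obtain ⟨d, -, x'', hx'', ed⟩ := hDm x' hx'
  have key : ∀ j : Fin (W.card * 2 ^ k + 1), ∃ p ∈ W ×ˢ D,
      |θ ^ k * p.1 + p.2 - d - 6 * (j : ℕ)| < 3 := by
    intro j
    obtain ⟨y, hy, w, hw, hlt⟩ := hall j j.2
    obtain ⟨Q, y', hy', ey, hQ⟩ := exists_level_polynomial h0 h1' hr0 hr1 hr hy N
    obtain ⟨d', hd', y'', hy'', ed'⟩ := hDm y' hy'
    have hval : aeval θ (Q - P - w) = aeval θ Q - aeval θ P - aeval θ w := by simp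
    have e1 : θ ^ (N + k) * (y - x) - 6 * (j : ℕ) - θ ^ k * aeval θ w =
        θ ^ k * (aeval θ (Q - P - w) + (y' - x')) - 6 * (j : ℕ) := by
      rw [hval, pow_add]; linear_combination θ ^ k * (ey - ex)
    have hj : (6 * (j : ℕ) : ℝ) ≤ θ ^ k := by
      refine le_trans ?_ hkJ
      have : (j : ℕ) ≤ W.card * 2 ^ k + 1 := j.2.le
      have : ((j : ℕ) : ℝ) ≤ (W.card * 2 ^ k + 1 : ℕ) := by exact_mod_cast this
      linarith
    have hj0 : (0 : ℝ) ≤ (j : ℕ) := by positivity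
    rw [e1, abs_lt] at hlt
    have b1 := K2 _ hx'
    have b2 := K2 _ hy'
    have b3 := K2 _ hx''
    have b4 := K2 _ hy''
    refine ⟨(aeval θ (Q - P - w), d'), Finset.mem_product.2 ⟨?_, hd'⟩, ?_⟩
    · rw [hW, Set.Finite.mem_toFinset]
      refine ⟨?_, _, rfl, (hQ.sub hP).sub hw⟩
      have c1 : aeval θ (Q - P - w) + (y' - x') < 2 := by
        by_contra hc
        have := mul_le_mul_of_nonneg_left (not_lt.1 hc) (by positivity : 0 ≤ θ ^ k)
        linarith
      have c2 : -1 < aeval θ (Q - P - w) + (y' - x') := by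
        by_contra hc
        have := mul_le_mul_of_nonneg_left (not_lt.1 hc) (by positivity : 0 ≤ θ ^ k)
        linarith
      rw [abs_le]; constructor <;> linarith
    · have e2 : θ ^ k * (aeval θ (Q - P - w) + (y' - x')) =
          θ ^ k * aeval θ (Q - P - w) + (d' - d) + (y'' - x'') := by
        linear_combination ed' - ed
      rw [e2] at hlt
      simp only
      rw [abs_lt]; constructor <;> linarith
  choose p hp hpj using key
  have hinj : Function.Injective p := by
    intro i j hij
    have hi := hpj i
    have hj := hpj j
    rw [hij] at hi
    rw [abs_lt] at hi hj
    have e1 : ((i : ℕ) : ℝ) < (j : ℕ) + 1 := by linarith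
    have e2 : ((j : ℕ) : ℝ) < (i : ℕ) + 1 := by linarith
    have e1' : (i : ℕ) < (j : ℕ) + 1 := by exact_mod_cast e1
    have e2' : (j : ℕ) < (i : ℕ) + 1 := by exact_mod_cast e2
    exact Fin.ext (by omega)
  have hcard := Finset.card_le_card_of_injOn (s := Finset.univ) (t := W ×ˢ D) p
    (fun i _ => hp i) hinj.injOn
  rw [Finset.card_univ, Fintype.card_fin, Finset.card_product] at hcard
  have := Nat.mul_le_mul_left W.card hD
  omega

/-! ### Irrational ratios and Pisot numbers -/

open Polynomial in
/-- The elements of `ℤ[θ]` with bounded other conjugates are relatively dense in `ℝ`: expand in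
base `θ` with digits of absolute value at most `θ`. -/
theorem exists_conjBounded_near {θ : ℝ} (hθ : IsPisot θ) :
    ∃ C : ℝ, ∀ y : ℝ, ∃ P : ℤ[X], ConjBounded θ C P ∧ |y - aeval θ P| ≤ 1 / 2 := by
  obtain ⟨r, hr0, hr1, hr⟩ := hθ.exists_conj_norm_le
  have hθ1 := hθ.2.1
  have hr' : 0 < 1 - r := by linarith
  refine ⟨θ / (1 - r), fun y => ?_⟩
  obtain ⟨N, hN⟩ := pow_unbounded_of_one_lt (2 * |y|) hθ1
  replace hN : |y| ≤ θ ^ N / 2 := by linarith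
  induction N generalizing y with
  | zero =>
    exact ⟨0, ConjBounded.zero (by positivity), by simpa using hN⟩
  | succ N ih =>
    obtain ⟨P, hP, hy⟩ := ih (y / θ) (by
      rw [abs_div, abs_of_pos (by linarith : 0 < θ), div_le_iff₀ (by linarith)]
      rw [pow_succ] at hN; linarith)
    set s := y - θ * aeval θ P with hs
    have hs1 : |s| ≤ θ / 2 := by
      have : s = θ * (y / θ - aeval θ P) := by rw [hs]; field_simp
      rw [this, abs_mul, abs_of_pos (by linarith : 0 < θ)]
      nlinarith
    refine ⟨X * P + C (round s), fun z hz hz' => ?_, ?_⟩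
    · have hd : ‖((round s : ℤ) : ℂ)‖ ≤ θ := by
        rw [← Complex.ofReal_intCast, Complex.norm_real, Real.norm_eq_abs]
        by_cases h0 : round s = 0
        · rw [h0]; simp; linarith
        · -- a non-zero rounded value is at most twice as large as the number itself
          have h1 := abs_sub_round s
          have h2 : (1 : ℝ) ≤ |((round s : ℤ) : ℝ)| := by
            rw [← Int.cast_abs]; exact_mod_cast Int.one_le_abs h0
          have h3 : |((round s : ℤ) : ℝ)| ≤ |s| + |s - round s| := by
            have := abs_sub_abs_le_abs_sub ((round s : ℤ) : ℝ) s
            rw [abs_sub_comm ((round s : ℤ) : ℝ) s] at this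
            linarith
          linarith
      have e : aeval z (X * P + C (round s)) = z * aeval z P + (round s : ℤ) := by simp
      rw [e]
      calc ‖z * aeval z P + (round s : ℤ)‖ ≤ r * (θ / (1 - r)) + θ := by
            refine (norm_add_le _ _).trans (add_le_add ?_ hd)
            rw [norm_mul]
            exact mul_le_mul (hr z hz hz') (hP z hz hz') (norm_nonneg _) hr0
        _ = θ / (1 - r) := by field_simp; ring
    · have e : y - aeval θ (X * P + C (round s)) = s - round s := by simp [hs]; ring
      rw [e]
      exact abs_sub_round s

/-- Given finitely many open, relatively dense sets of reals, the scale `c` can be confined to an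
interval on which `c / β ^ (i j)` lies in the `j`-th set for suitable exponents `i j`. -/
theorem exists_Ioo_forall_div_pow_mem {β L : ℝ} (hβ0 : 0 < β) (hβ1 : β < 1) (U : ℕ → Set ℝ)
    (hU : ∀ j, IsOpen (U j)) (hL : ∀ j y, ∃ z ∈ U j, y ≤ z ∧ z ≤ y + L) (J : ℕ) :
    ∃ (v w : ℝ) (i : ℕ → ℕ), 0 < v ∧ v < w ∧
      ∀ c, v < c → c < w → ∀ j < J, c / β ^ i j ∈ U j := by
  induction J with
  | zero => exact ⟨1, 2, fun _ => 0, one_pos, by norm_num, by simp⟩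
  | succ J ih =>
    obtain ⟨v, w, i, hv, hvw, h⟩ := ih
    have hL0 : 0 ≤ L := by
      obtain ⟨z, -, h1, h2⟩ := hL 0 0
      linarith
    obtain ⟨e, he⟩ := exists_pow_lt_of_lt_one (show 0 < (w - v) / (2 * (L + 1)) by
      apply div_pos <;> linarith) hβ1
    rw [lt_div_iff₀ (by linarith)] at he
    have hβe : 0 < β ^ e := by positivity
    obtain ⟨z, hz, hz1, hz2⟩ := hL J ((v + w) / 2 / β ^ e)
    have hzv : v < z * β ^ e := by
      rw [div_le_iff₀ hβe] at hz1; linarith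
    have hzw : z * β ^ e < w := by
      have : z * β ^ e ≤ (v + w) / 2 + L * β ^ e := by
        have := mul_le_mul_of_nonneg_right hz2 hβe.le
        rw [add_mul, div_mul_cancel₀ _ hβe.ne'] at this
        exact this
      nlinarith
    have hopen : IsOpen {c : ℝ | c / β ^ e ∈ U J} := (hU J).preimage (by fun_prop)
    have hmem : z * β ^ e ∈ {c : ℝ | c / β ^ e ∈ U J} := by
      simpa [hβe.ne'] using hz
    obtain ⟨v', w', ⟨h1, h2⟩, hsub⟩ := mem_nhds_iff_exists_Ioo_subset.1 (hopen.mem_nhds hmem)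
    refine ⟨max v v', min w w', Function.update i J e, lt_max_of_lt_left hv,
      (max_lt hzv h1).trans (lt_min hzw h2), fun c hc1 hc2 j hj => ?_⟩
    rw [max_lt_iff] at hc1
    rw [lt_min_iff] at hc2
    rcases Nat.lt_succ_iff_lt_or_eq.1 hj with hj | rfl
    · rw [Function.update_of_ne hj.ne]
      exact h c hc1.1 hc2.1 j hj
    · rw [Function.update_self]
      exact hsub ⟨hc1.2, hc2.2⟩

open Polynomial in
/-- If `1 / α` is a Pisot number, the ratio is rational: otherwise the scale of a blow-up can be
chosen such that the differences `c β ^ n` approach all cosets of `exists_coset_avoided`. -/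
theorem exists_rat_of_isPisot {α β : ℝ} (hβ0 : 0 < β) (hβα : β < α) (hα : α < 1 / 2)
    (hθ : IsPisot (1 / α)) (h : AffinelyEmbeds (centralCantorSet β) (centralCantorSet α)) :
    ∃ q : ℚ, Real.log β / Real.log α = (q : ℝ) := by
  have hα0 : 0 < α := hβ0.trans hβα
  by_contra hq
  have hirr : Irrational (Real.log β / Real.log α) := fun ⟨q, hq'⟩ => hq ⟨q, hq'.symm⟩
  obtain ⟨x, c, hc, hK⟩ :=
    exists_finsum_mem_of_affinelyEmbeds hβ0 (by linarith) hα0 (by linarith) h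
  obtain ⟨C, hC⟩ := exists_conjBounded_near hθ
  obtain ⟨k, J, hkJ⟩ := exists_coset_avoided hα0 hα hθ C
  have hθk : 0 < (1 / α) ^ k := by positivity
  obtain ⟨v, w, i, hv, hvw, hi⟩ := exists_Ioo_forall_div_pow_mem (L := (1 / α) ^ k) hβ0
    (by linarith) (fun j => {t | ∃ w : ℤ[X], ConjBounded (1 / α) C w ∧
        |t - 6 * j - (1 / α) ^ k * aeval (1 / α) w| < 1}) (fun j => by
      have e : {t : ℝ | ∃ w : ℤ[X], ConjBounded (1 / α) C w ∧
          |t - 6 * j - (1 / α) ^ k * aeval (1 / α) w| < 1} =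
          ⋃ w : {w : ℤ[X] // ConjBounded (1 / α) C w},
            {t : ℝ | |t - 6 * j - (1 / α) ^ k * aeval (1 / α) w.1| < 1} := by
        ext t; simp
      rw [e]
      exact isOpen_iUnion fun w => isOpen_lt (by fun_prop) (by fun_prop)) (fun j y => by
      obtain ⟨P, hP, hy⟩ := hC ((y + (1 / α) ^ k / 2 - 6 * j) / (1 / α) ^ k)
      refine ⟨6 * j + (1 / α) ^ k * aeval (1 / α) P, ⟨P, hP, by simp⟩, ?_⟩
      have e : (y + (1 / α) ^ k / 2 - 6 * j) / (1 / α) ^ k * (1 / α) ^ k =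
        y + (1 / α) ^ k / 2 - 6 * j := div_mul_cancel₀ _ hθk.ne'
      rw [abs_le] at hy
      have h1 := mul_le_mul_of_nonneg_right hy.1 hθk.le
      have h2 := mul_le_mul_of_nonneg_right hy.2 hθk.le
      rw [sub_mul, e] at h1 h2
      constructor <;> linarith) J
  obtain ⟨n, M, hn, hM, h1, h2⟩ := exists_pow_mul_mem_Ioo (m := max k ((Finset.range J).sup i))
    hα0 (by linarith) hβ0 (by linarith) hirr hc hv hvw
  obtain ⟨N, rfl⟩ : ∃ N, M = N + k := ⟨M - k, by omega⟩
  have hαM : 0 < α ^ (N + k) := by positivity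
  refine hkJ N x (by simpa using hK ∅) fun j hj => ?_
  have hji : i j ≤ n := by
    have : i j ≤ (Finset.range J).sup i := Finset.le_sup (Finset.mem_range.2 hj)
    omega
  obtain ⟨w, hw, hlt⟩ := hi ((1 / α) ^ (N + k) * (c * β ^ n)) (by
    rw [one_div, inv_pow, inv_mul_eq_div, lt_div_iff₀ hαM]; linarith) (by
    rw [one_div, inv_pow, inv_mul_eq_div, div_lt_iff₀ hαM]; linarith) j hj
  refine ⟨x + c * β ^ (n - i j), by simpa using hK {n - i j}, w, hw, ?_⟩
  convert! hlt using 4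
  rw [add_sub_cancel_left, pow_sub₀ _ hβ0.ne' hji]
  field_simp

/-! ### Linear recurrences -/

section

open Polynomial IntermediateField

/-- A polynomial in the shift operator acts on sequences as the corresponding linear
recurrence. -/
theorem aeval_funLeft_apply (p : ℝ[X]) (e : ℕ → ℝ) (i : ℕ) :
    aeval (LinearMap.funLeft ℝ ℝ (fun n : ℕ => n + 1)) p e i =
      ∑ k ∈ Finset.range (p.natDegree + 1), p.coeff k * e (i + k) := by
  have hpow : ∀ k, ((LinearMap.funLeft ℝ ℝ (fun n : ℕ => n + 1)) ^ k) e i = e (i + k) := by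
    intro k
    induction k generalizing i with
    | zero => simp
    | succ k ih =>
      rw [pow_succ', Module.End.mul_apply, LinearMap.funLeft_apply, ih]
      congr 1; ring
  rw [aeval_eq_sum_range, LinearMap.sum_apply, Finset.sum_apply]
  exact Finset.sum_congr rfl fun k _ => by
    rw [LinearMap.smul_apply, Pi.smul_apply, hpow, smul_eq_mul]

theorem aeval_funLeft_geom (p : ℝ[X]) (c a : ℝ) (i : ℕ) :
    aeval (LinearMap.funLeft ℝ ℝ (fun n : ℕ => n + 1)) p (fun i => c * a ^ i) i =
      c * a ^ i * p.eval a := by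
  rw [aeval_funLeft_apply, eval_eq_sum_range, Finset.mul_sum]
  exact Finset.sum_congr rfl fun k _ => by rw [pow_add]; ring

theorem eval_minpolyDiv_ne_zero {a : ℝ} (ha : IsIntegral ℚ a) : (minpolyDiv ℚ a).eval a ≠ 0 := by
  rw [eval_minpolyDiv_self]
  exact (minpoly.irreducible ha).separable.aeval_derivative_ne_zero (minpoly.aeval _ _)

theorem coeff_minpolyDiv_mem (a : ℝ) (i : ℕ) : (minpolyDiv ℚ a).coeff i ∈ ℚ⟮a⟯ :=
  algebra_adjoin_le_adjoin ℚ _ (coeff_minpolyDiv_mem_adjoin (R := ℚ) a i)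

theorem eval_minpolyDiv_mem (a : ℝ) : (minpolyDiv ℚ a).eval a ∈ ℚ⟮a⟯ := by
  rw [eval_eq_sum_range]
  exact sum_mem fun k _ => mul_mem (coeff_minpolyDiv_mem a k)
    (pow_mem (mem_adjoin_simple_self ℚ a) k)

/-- Pisot's theorem for algebraic integers: if `c a ^ i` approaches the integers as `i → ∞`, then
`c ∈ ℚ(a)`. The nearest integers eventually satisfy the recurrence of the minimal polynomial `f` of
`a`; applying `f / (X - a)` to the sequence removes the decaying part and leaves a multiple of
`c a ^ i`. -/
theorem mem_adjoin_of_tendsto_sub_round {a c : ℝ} (ha : IsIntegral ℤ a) (ha1 : 1 < a)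
    (h : Tendsto (fun i : ℕ => c * a ^ i - round (c * a ^ i)) atTop (𝓝 0)) : c ∈ ℚ⟮a⟯ := by
  have haQ : IsIntegral ℚ a := ha.tower_top
  set S := LinearMap.funLeft ℝ ℝ (fun n : ℕ => n + 1) with hS
  set n : ℕ → ℝ := fun i => round (c * a ^ i) with hn
  set e : ℕ → ℝ := fun i => c * a ^ i - round (c * a ^ i) with he
  have hen : e = (fun i => c * a ^ i) - n := rfl
  set b := minpolyDiv ℚ a with hb
  set F : ℤ[X] := minpoly ℤ a with hF
  have hspec : b * (X - C a) = F.map (algebraMap ℤ ℝ) := by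
    rw [hb, ← minpolyDiv_eq_of_isIntegrallyClosed (R := ℤ) ℚ ha, minpolyDiv_spec]
  have lim : ∀ p : ℝ[X], Tendsto (fun i => aeval S p e i) atTop (𝓝 0) := by
    intro p
    simp only [hS, aeval_funLeft_apply]
    have : Tendsto (fun i => ∑ k ∈ Finset.range (p.natDegree + 1), p.coeff k * e (i + k)) atTop
        (𝓝 (∑ k ∈ Finset.range (p.natDegree + 1), p.coeff k * 0)) :=
      tendsto_finsetSum _ fun k _ => ((tendsto_add_atTop_iff_nat k).2 h).const_mul _
    simpa using this
  have hint : ∀ i, ∃ m : ℤ, aeval S (F.map (algebraMap ℤ ℝ)) e i = m := by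
    intro i
    refine ⟨-∑ k ∈ Finset.range ((F.map (algebraMap ℤ ℝ)).natDegree + 1),
      F.coeff k * round (c * a ^ (i + k)), ?_⟩
    have hroot : (F.map (algebraMap ℤ ℝ)).eval a = 0 := by
      rw [eval_map_algebraMap, hF, minpoly.aeval]
    rw [hen, map_sub, Pi.sub_apply, hS, aeval_funLeft_geom, hroot, mul_zero, zero_sub,
      aeval_funLeft_apply]
    push_cast
    simp [hn]
  obtain ⟨I, hI⟩ : ∃ I, ∀ i ≥ I, aeval S (F.map (algebraMap ℤ ℝ)) e i = 0 := by
    obtain ⟨I, hI⟩ := Metric.tendsto_atTop.1 (lim (F.map (algebraMap ℤ ℝ))) 1 one_pos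
    refine ⟨I, fun i hi => ?_⟩
    obtain ⟨m, hm⟩ := hint i
    have := hI i hi
    rw [hm, dist_zero_right, Real.norm_eq_abs, ← Int.cast_abs] at this
    have : |m| < 1 := by exact_mod_cast this
    rw [hm, Int.abs_lt_one_iff.1 this, Int.cast_zero]
  set E := aeval S b e with hE
  have hrec : ∀ i ≥ I, E (i + 1) = a * E i := by
    intro i hi
    have h1 := hI i hi
    rw [← hspec, mul_comm, map_mul, Module.End.mul_apply, map_sub, aeval_X, aeval_C,
      LinearMap.sub_apply, Pi.sub_apply, Module.algebraMap_end_apply, Pi.smul_apply, smul_eq_mul,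
      hS, LinearMap.funLeft_apply] at h1
    linarith
  have hgeo : ∀ k, E (I + k) = a ^ k * E I := by
    intro k
    induction k with
    | zero => simp
    | succ k ih => rw [← add_assoc, hrec _ (by omega), ih, pow_succ]; ring
  have hE0 : E I = 0 := by
    by_contra hne
    obtain ⟨i₀, hi₀⟩ := Metric.tendsto_atTop.1 (lim b) |E I| (abs_pos.2 hne)
    have h1 := hi₀ (I + i₀) (by omega)
    rw [dist_zero_right, Real.norm_eq_abs, ← hE, hgeo, abs_mul] at h1
    have : 1 ≤ |a ^ i₀| := by
      rw [abs_of_pos (by positivity)]; exact one_le_pow₀ ha1.le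
    nlinarith [abs_nonneg (E I)]
  rw [hE, hen, map_sub, Pi.sub_apply, hS, aeval_funLeft_geom, sub_eq_zero] at hE0
  have hba : b.eval a ≠ 0 := eval_minpolyDiv_ne_zero haQ
  have hai : a ^ I ≠ 0 := by positivity
  have hc : c = aeval S b n I / (a ^ I * b.eval a) := by
    rw [hS, ← hE0]; field_simp
  rw [hc]
  refine div_mem ?_ (mul_mem (pow_mem (mem_adjoin_simple_self ℚ a) I) (eval_minpolyDiv_mem a))
  rw [hS, aeval_funLeft_apply]
  exact sum_mem fun k _ => mul_mem (coeff_minpolyDiv_mem a k) (intCast_mem _ _)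

/-- A real number whose products with the coefficients of `f / ((X - θ) f'(θ))` are close to
integers is close to an element of `ℤ[θ]` with small other conjugates; here `f` is the minimal
polynomial of `θ`. That quotient is `1` at `θ` and `0` at the other conjugates. -/
theorem exists_conjBounded_near_of_near_int {θ : ℝ} (hθ : IsIntegral ℤ θ) {η : ℝ}
    (hη : 0 < η) :
    ∃ (d : ℕ) (κ : Fin d → ℝ) (ε : ℝ), (∀ j, κ j ∈ ℚ⟮θ⟯) ∧ 0 < ε ∧
      ∀ y : ℝ, (∀ j, |κ j * y - round (κ j * y)| < ε) →
        ∃ P : ℤ[X], ConjBounded θ 1 P ∧ |y - aeval θ P| < η := by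
  have hθQ : IsIntegral ℚ θ := hθ.tower_top
  set b := minpolyDiv ℚ θ with hb
  set d := b.natDegree + 1 with hd
  have hbθ : b.eval θ ≠ 0 := eval_minpolyDiv_ne_zero hθQ
  set κ : Fin d → ℝ := fun j => b.coeff j / b.eval θ with hκ
  set T : ℝ := ∑ j : Fin d, |θ| ^ (j : ℕ) with hT
  have hT0 : 0 ≤ T := Finset.sum_nonneg fun j _ => by positivity
  -- The constant must also control the powers of all conjugates, so it is summed over them.
  set s : Finset ℂ := ((minpoly ℚ θ).rootSet_finite ℂ).toFinset with hs
  set T' : ℝ := ∑ z ∈ s, ∑ j : Fin d, ‖z‖ ^ (j : ℕ) with hT'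
  have hT'0 : 0 ≤ T' := Finset.sum_nonneg fun z _ => Finset.sum_nonneg fun j _ => by positivity
  have key : ∀ (z : ℂ) (ε y : ℝ), 0 ≤ ε → (∀ j, |κ j * y - round (κ j * y)| < ε) →
      ‖(∑ j : Fin d, (κ j : ℂ) * z ^ (j : ℕ)) * y -
        aeval z (∑ j : Fin d, C (round (κ j * y)) * X ^ (j : ℕ))‖ ≤
        ε * ∑ j : Fin d, ‖z‖ ^ (j : ℕ) := by
    intro z ε y hε h
    have e1 : (∑ j : Fin d, (κ j : ℂ) * z ^ (j : ℕ)) * y -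
        aeval z (∑ j : Fin d, C (round (κ j * y)) * X ^ (j : ℕ)) =
        ∑ j : Fin d, ((κ j * y - round (κ j * y) : ℝ) : ℂ) * z ^ (j : ℕ) := by
      rw [map_sum, Finset.sum_mul, ← Finset.sum_sub_distrib]
      refine Finset.sum_congr rfl fun j _ => ?_
      simp
      ring
    rw [e1, Finset.mul_sum]
    refine (norm_sum_le _ _).trans (Finset.sum_le_sum fun j _ => ?_)
    rw [norm_mul, norm_pow, Complex.norm_real, Real.norm_eq_abs]
    exact mul_le_mul_of_nonneg_right (h j).le (by positivity)
  have hsum : ∀ z : ℂ, ∑ j : Fin d, (κ j : ℂ) * z ^ (j : ℕ) = aeval z b / (b.eval θ : ℝ) := by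
    intro z
    rw [aeval_eq_sum_range, Finset.sum_div, ← Fin.sum_univ_eq_sum_range
      (fun k => b.coeff k • z ^ k / ((b.eval θ : ℝ) : ℂ))]
    refine Finset.sum_congr rfl fun j _ => ?_
    simp [hκ]
    ring
  refine ⟨d, κ, min (η / (T + 1)) (1 / (T' + 1)), fun j => div_mem (coeff_minpolyDiv_mem θ _)
    (eval_minpolyDiv_mem θ), by positivity, fun y hy =>
    ⟨∑ j : Fin d, C (round (κ j * y)) * X ^ (j : ℕ), fun z hz hz' => ?_, ?_⟩⟩
  · have h0 : aeval z b = 0 := by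
      have h1 := congrArg (aeval z) (minpolyDiv_spec ℚ θ)
      rw [aeval_map_algebraMap, hz, map_mul, mul_eq_zero] at h1
      refine h1.resolve_right ?_
      simpa [sub_eq_zero] using hz'
    have h1 := key z _ y (by positivity) hy
    rw [hsum, h0, zero_div, zero_mul, zero_sub, norm_neg] at h1
    refine h1.trans ?_
    have hzs : z ∈ s := by
      rw [hs, Set.Finite.mem_toFinset]
      exact mem_rootSet.2 ⟨minpoly.ne_zero hθQ, hz⟩
    have h2 : ∑ j : Fin d, ‖z‖ ^ (j : ℕ) ≤ T' :=
      Finset.single_le_sum (f := fun z : ℂ => ∑ j : Fin d, ‖z‖ ^ (j : ℕ))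
        (fun z _ => Finset.sum_nonneg fun j _ => by positivity) hzs
    calc _ ≤ 1 / (T' + 1) * T' := mul_le_mul (min_le_right _ _) h2
            (Finset.sum_nonneg fun j _ => by positivity) (by positivity)
      _ ≤ 1 := by rw [one_div, inv_mul_le_iff₀ (by linarith)]; linarith
  · have h1 := key (θ : ℂ) _ y (by positivity) hy
    have e1 : aeval (θ : ℂ) b = ((b.eval θ : ℝ) : ℂ) := by
      rw [← Complex.coe_algebraMap, aeval_algebraMap_apply, coe_aeval_eq_eval]
    have hbθ' : ((b.eval θ : ℝ) : ℂ) ≠ 0 := by exact_mod_cast hbθ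
    rw [hsum, e1, div_self hbθ', one_mul, ← Complex.coe_algebraMap, aeval_algebraMap_apply,
      ← map_sub, Complex.coe_algebraMap, Complex.norm_real, Real.norm_eq_abs] at h1
    refine h1.trans_lt ?_
    have : ∑ j : Fin d, ‖(θ : ℂ)‖ ^ (j : ℕ) = T := by simp [hT]
    rw [this]
    calc _ ≤ η / (T + 1) * T := mul_le_mul_of_nonneg_right (min_le_left _ _) hT0
      _ < η := by rw [div_mul_eq_mul_div, div_lt_iff₀ (by linarith)]; nlinarith

end

/-! ### Finite sums modulo one -/

/-- The additive character `t ↦ exp (2 π i t)` of `ℝ / ℤ`. -/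
noncomputable def expTwoPi (t : ℝ) : ℂ := Complex.exp (((2 * Real.pi * t : ℝ) : ℂ) * Complex.I)

theorem expTwoPi_add (s t : ℝ) : expTwoPi (s + t) = expTwoPi s * expTwoPi t := by
  rw [expTwoPi, expTwoPi, expTwoPi, ← Complex.exp_add]
  congr 1
  push_cast
  ring

theorem expTwoPi_zero : expTwoPi 0 = 1 := by simp [expTwoPi]

theorem norm_expTwoPi (t : ℝ) : ‖expTwoPi t‖ = 1 := Complex.norm_exp_ofReal_mul_I _

theorem expTwoPi_sum {ι : Type*} (s : Finset ι) (f : ι → ℝ) :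
    expTwoPi (∑ i ∈ s, f i) = ∏ i ∈ s, expTwoPi (f i) := by
  classical
  induction s using Finset.induction_on with
  | empty => simp [expTwoPi_zero]
  | insert a s ha ih => rw [Finset.sum_insert ha, Finset.prod_insert ha, expTwoPi_add, ih]

theorem expTwoPi_nat_mul (n : ℕ) (t : ℝ) : expTwoPi (n * t) = expTwoPi t ^ n := by
  induction n with
  | zero => simp [expTwoPi_zero]
  | succ n ih => rw [pow_succ, ← ih, ← expTwoPi_add]; congr 1; push_cast; ring

theorem one_add_expTwoPi (t : ℝ) :
    (1 + expTwoPi t) / 2 = (Real.cos (Real.pi * t) : ℂ) * expTwoPi (t / 2) := by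
  have e : expTwoPi t = expTwoPi (t / 2) * expTwoPi (t / 2) := by
    rw [← expTwoPi_add]; congr 1; ring
  have e2 : expTwoPi (-(t / 2)) * expTwoPi (t / 2) = 1 := by
    rw [← expTwoPi_add, neg_add_cancel, expTwoPi_zero]
  have e3 : (Real.cos (Real.pi * t) : ℂ) = (expTwoPi (t / 2) + expTwoPi (-(t / 2))) / 2 := by
    rw [Complex.ofReal_cos, Complex.cos, expTwoPi, expTwoPi]
    congr 3 <;> (congr 1; push_cast; ring)
  rw [e3, e]
  linear_combination (-1 / 2 : ℂ) * e2

theorem cos_sq_le_of_le_abs_sub_round {δ t : ℝ} (hδ0 : 0 ≤ δ) (h : δ ≤ |t - round t|) :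
    Real.cos (Real.pi * t) ^ 2 ≤ Real.cos (Real.pi * δ) ^ 2 := by
  have hhalf := abs_sub_round t
  have e : Real.cos (Real.pi * t) ^ 2 = Real.cos (Real.pi * |t - round t|) ^ 2 := by
    rw [← Real.cos_abs (Real.pi * |t - round t|), abs_mul, abs_abs, ← abs_mul, Real.cos_abs,
      mul_sub, mul_comm Real.pi ((round t : ℤ) : ℝ), Real.cos_sub_int_mul_pi, mul_pow]
    rcases Int.even_or_odd (round t) with hr | hr
    · rw [hr.neg_one_zpow]; ring
    · rw [hr.neg_one_zpow]; ring
  have hpi := Real.pi_pos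
  rw [e]
  have h1 : Real.cos (Real.pi * |t - round t|) ≤ Real.cos (Real.pi * δ) :=
    Real.cos_le_cos_of_nonneg_of_le_pi (by positivity) (by nlinarith) (by nlinarith)
  have h0 : 0 ≤ Real.cos (Real.pi * |t - round t|) :=
    Real.cos_nonneg_of_mem_Icc ⟨by nlinarith [abs_nonneg (t - round t)], by nlinarith⟩
  nlinarith

theorem cos_pi_mul_sq_lt_one {δ : ℝ} (h0 : 0 < δ) (h1 : δ ≤ 1 / 2) :
    Real.cos (Real.pi * δ) ^ 2 < 1 := by
  have hs : 0 < Real.sin (Real.pi * δ) :=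
    Real.sin_pos_of_pos_of_lt_pi (by have := Real.pi_pos; positivity) (by
      have := Real.pi_pos; nlinarith)
  nlinarith [Real.sin_sq_add_cos_sq (Real.pi * δ)]

/-- The characteristic function of the sum of the `t i`, each multiplied by an independent random
digit `0` or `1`, tends to zero unless `t i` approaches the integers. -/
theorem tendsto_prod_one_add_expTwoPi {t : ℕ → ℝ}
    (h : ¬ Tendsto (fun i => t i - round (t i)) atTop (𝓝 0)) :
    Tendsto (fun I => ∏ i ∈ Finset.range I, ((1 + expTwoPi (t i)) / 2)) atTop (𝓝 0) := by
  have hnorm : ∀ s, ‖(1 + expTwoPi s) / 2‖ = |Real.cos (Real.pi * s)| := fun s => by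
    rw [one_add_expTwoPi, norm_mul, norm_expTwoPi, mul_one, Complex.norm_real, Real.norm_eq_abs]
  obtain ⟨δ, hδ, hfreq⟩ : ∃ δ > 0, ∀ n, ∃ i ≥ n, δ ≤ |t i - round (t i)| := by
    rw [Metric.tendsto_atTop] at h
    push Not at h
    simpa only [dist_zero_right, Real.norm_eq_abs] using h
  have hδ2 : δ ≤ 1 / 2 := by
    obtain ⟨i, -, hi⟩ := hfreq 0
    exact hi.trans (abs_sub_round _)
  set ρ := |Real.cos (Real.pi * δ)| with hρ
  have hρ0 : 0 ≤ ρ := abs_nonneg _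
  have hρ1 : ρ < 1 := by
    rw [hρ, ← sq_lt_one_iff_abs_lt_one]; exact cos_pi_mul_sq_lt_one hδ hδ2
  set f : ℕ → ℝ := fun I => ∏ i ∈ Finset.range I, |Real.cos (Real.pi * t i)| with hf
  have hf0 : ∀ I, 0 ≤ f I := fun I => Finset.prod_nonneg fun i _ => abs_nonneg _
  have hanti : Antitone f := antitone_nat_of_succ_le fun I => by
    rw [hf]
    simp only [Finset.prod_range_succ]
    exact mul_le_of_le_one_right (hf0 I) (Real.abs_cos_le_one _)
  have hpow : ∀ n, ∃ I, f I ≤ ρ ^ n := by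
    intro n
    induction n with
    | zero => exact ⟨0, by simp [hf]⟩
    | succ n ih =>
      obtain ⟨I, hI⟩ := ih
      obtain ⟨i, hi, hδi⟩ := hfreq I
      refine ⟨i + 1, ?_⟩
      have h1 : |Real.cos (Real.pi * t i)| ≤ ρ :=
        sq_le_sq.1 (cos_sq_le_of_le_abs_sub_round hδ.le hδi)
      rw [hf]
      simp only [Finset.prod_range_succ]
      rw [pow_succ]
      exact mul_le_mul ((hanti hi).trans hI) h1 (abs_nonneg _) (by positivity)
  rw [tendsto_zero_iff_norm_tendsto_zero]
  have e : (fun I => ‖∏ i ∈ Finset.range I, ((1 + expTwoPi (t i)) / 2)‖) = f := by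
    funext I
    rw [norm_prod]
    exact Finset.prod_congr rfl fun i _ => hnorm _
  rw [e, Metric.tendsto_atTop]
  intro ε hε
  obtain ⟨n, hn⟩ := exists_pow_lt_of_lt_one hε hρ1
  obtain ⟨I, hI⟩ := hpow n
  refine ⟨I, fun m hm => ?_⟩
  rw [dist_zero_right, Real.norm_of_nonneg (hf0 m)]
  exact ((hanti hm).trans hI).trans_lt hn

/-- The Fourier expansion of `cos (π t) ^ (2 R)`. -/
theorem cos_pi_mul_pow (R : ℕ) (t : ℝ) :
    ((Real.cos (Real.pi * t) ^ (2 * R) : ℝ) : ℂ) = ∑ l ∈ Finset.range (2 * R + 1),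
      (((2 * R).choose l / 4 ^ R : ℝ) : ℂ) * expTwoPi (((l : ℝ) - R) * t) := by
  have h1 : ((Real.cos (Real.pi * t) ^ (2 * R) : ℝ) : ℂ) =
      ((1 + expTwoPi t) / 2) ^ (2 * R) * expTwoPi (-(R * t)) := by
    rw [one_add_expTwoPi, mul_pow, ← expTwoPi_nat_mul, mul_assoc, ← expTwoPi_add]
    have : (2 * R : ℕ) * (t / 2) + -(R * t) = 0 := by push_cast; ring
    rw [this, expTwoPi_zero, mul_one]
    push_cast
    rfl
  rw [h1, div_pow, add_comm, add_pow, Finset.sum_div, Finset.sum_mul]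
  refine Finset.sum_congr rfl fun l _ => ?_
  have : ((l : ℝ) - R) * t = l * t + -(R * t) := by ring
  rw [this, expTwoPi_add, expTwoPi_nat_mul, pow_mul]
  push_cast
  norm_num
  ring

/-- If no non-zero integer combination `ξ` of the `κ j` makes `ξ v i` approach the integers, the
finite subsums of `v` come close to every `g` modulo one after multiplication by each `κ j`. The
average of `∏ j, cos (π κ j (s - g)) ^ (2 R)` over the subsums `s` of the first `I` terms has a limit
that is at least `(centralBinom R / 4 ^ R) ^ d`, while this product would be exponentially small in
`R` if all subsums stayed away. -/
theorem exists_finset_sum_near_int {d : ℕ} (κ : Fin d → ℝ) (v : ℕ → ℝ) (g : ℝ)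
    (hv : ∀ m : Fin d → ℤ, ∑ j, m j * κ j ≠ 0 →
      ¬ Tendsto (fun i => (∑ j, m j * κ j) * v i - round ((∑ j, m j * κ j) * v i)) atTop (𝓝 0))
    {ε : ℝ} (hε : 0 < ε) :
    ∃ S : Finset ℕ, ∀ j, |κ j * (∑ i ∈ S, v i - g) - round (κ j * (∑ i ∈ S, v i - g))| < ε := by
  by_contra! hcon
  obtain ⟨j₀, hj₀⟩ := hcon ∅
  have hε2 : ε ≤ 1 / 2 := hj₀.trans (abs_sub_round _)
  set ρ := Real.cos (Real.pi * ε) ^ 2 with hρ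
  have hρ0 : 0 ≤ ρ := sq_nonneg _
  have hρ1 : ρ < 1 := cos_pi_mul_sq_lt_one hε hε2
  have main : ∀ R : ℕ, ((R.centralBinom : ℝ) / 4 ^ R) ^ d ≤ ρ ^ R := by
    intro R
    set L := Fintype.piFinset fun _ : Fin d => Finset.range (2 * R + 1) with hL
    set a : (Fin d → ℕ) → ℝ := fun l => ∏ j, (((2 * R).choose (l j) : ℝ) / 4 ^ R) with ha
    set ξ : (Fin d → ℕ) → ℝ := fun l => ∑ j, ((l j : ℝ) - R) * κ j with hξ
    have ha0 : ∀ l, 0 ≤ a l := fun l => Finset.prod_nonneg fun j _ => by positivity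
    set F : ℝ → ℝ := fun s => ∏ j, Real.cos (Real.pi * (κ j * (s - g))) ^ (2 * R) with hF
    have hexp : ∀ s, (F s : ℂ) = ∑ l ∈ L, ((a l : ℂ) * expTwoPi (-(ξ l * g))) *
        expTwoPi (ξ l * s) := by
      intro s
      rw [hF]
      simp only [Complex.ofReal_prod]
      simp only [cos_pi_mul_pow]
      rw [Finset.prod_univ_sum]
      refine Finset.sum_congr rfl fun l _ => ?_
      rw [Finset.prod_mul_distrib, ← expTwoPi_sum, mul_assoc, ← expTwoPi_add, ha]
      simp only [Complex.ofReal_prod]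
      congr 2
      rw [hξ, ← neg_mul, ← Finset.sum_neg_distrib, Finset.sum_mul, Finset.sum_mul,
        ← Finset.sum_add_distrib]
      exact Finset.sum_congr rfl fun j _ => by ring
    have hFle : ∀ S : Finset ℕ, F (∑ i ∈ S, v i) ≤ ρ ^ R := by
      intro S
      obtain ⟨j, hj⟩ := hcon S
      rw [hF]
      simp only
      rw [← Finset.mul_prod_erase _ _ (Finset.mem_univ j)]
      have h1 : Real.cos (Real.pi * (κ j * (∑ i ∈ S, v i - g))) ^ (2 * R) ≤ ρ ^ R := by
        rw [pow_mul]
        exact pow_le_pow_left₀ (sq_nonneg _) (cos_sq_le_of_le_abs_sub_round hε.le hj) R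
      refine (mul_le_of_le_one_right (by rw [pow_mul]; positivity) ?_).trans h1
      refine Finset.prod_le_one (fun j _ => by rw [pow_mul]; positivity) fun j _ => ?_
      rw [pow_mul]
      exact pow_le_one₀ (sq_nonneg _) (Real.cos_sq_le_one _)
    -- the averages over the subsums of the first `I` terms
    set A : ℕ → ℝ := fun I =>
      (∑ S ∈ (Finset.range I).powerset, F (∑ i ∈ S, v i)) / 2 ^ I with hA
    have hAle : ∀ I, A I ≤ ρ ^ R := by
      intro I
      rw [hA]
      simp only
      rw [div_le_iff₀ (by positivity)]
      refine (Finset.sum_le_card_nsmul _ _ _ fun S _ => hFle S).trans_eq ?_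
      rw [Finset.card_powerset, Finset.card_range, nsmul_eq_mul]
      push_cast
      ring
    have hAexp : ∀ I, (A I : ℂ) = ∑ l ∈ L, ((a l : ℂ) * expTwoPi (-(ξ l * g))) *
        ∏ i ∈ Finset.range I, ((1 + expTwoPi (ξ l * v i)) / 2) := by
      intro I
      rw [hA]
      push_cast
      simp only [hexp]
      rw [Finset.sum_comm, Finset.sum_div]
      refine Finset.sum_congr rfl fun l _ => ?_
      rw [← Finset.mul_sum, mul_div_assoc]
      congr 1
      rw [Finset.prod_div_distrib, Finset.prod_const, Finset.card_range, Finset.prod_one_add]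
      congr 1
      refine Finset.sum_congr rfl fun S _ => ?_
      rw [Finset.mul_sum, expTwoPi_sum]
    have hlim : Tendsto (fun I => (A I : ℂ)) atTop
        (𝓝 (∑ l ∈ L, if ξ l = 0 then (a l : ℂ) else 0)) := by
      simp only [hAexp]
      refine tendsto_finsetSum _ fun l _ => ?_
      split_ifs with h0
      · simp [h0, expTwoPi_zero]
      · have e : ξ l = ∑ j, (((l j : ℤ) - (R : ℤ) : ℤ) : ℝ) * κ j := by
          rw [hξ]; push_cast; rfl
        have := hv (fun j => (l j : ℤ) - R) (by rw [← e]; exact h0)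
        rw [← e] at this
        simpa using (tendsto_prod_one_add_expTwoPi this).const_mul
          ((a l : ℂ) * expTwoPi (-(ξ l * g)))
    have hlim' : Tendsto A atTop (𝓝 (∑ l ∈ L, if ξ l = 0 then a l else 0)) := by
      have e : (∑ l ∈ L, if ξ l = 0 then (a l : ℂ) else 0) =
          ((∑ l ∈ L, if ξ l = 0 then a l else 0 : ℝ) : ℂ) := by
        push_cast
        exact Finset.sum_congr rfl fun l _ => by split_ifs <;> simp
      rw [e] at hlim
      exact (Complex.continuous_re.tendsto _).comp hlim
    have h1 := le_of_tendsto' hlim' hAle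
    refine le_trans ?_ h1
    have hmem : (fun _ : Fin d => R) ∈ L := by
      rw [hL, Fintype.mem_piFinset]; intro j; rw [Finset.mem_range]; omega
    have h2 := Finset.single_le_sum (f := fun l => if ξ l = 0 then a l else 0)
      (fun l _ => by split_ifs; exacts [ha0 l, le_rfl]) hmem
    refine le_trans (le_of_eq ?_) h2
    have h3 : ξ (fun _ => R) = 0 := by simp [hξ]
    simp only [h3, if_true, ha]
    rw [Finset.prod_const, Finset.card_univ, Fintype.card_fin, Nat.centralBinom]
  -- `4 ^ R ≤ 2 R centralBinom R`, so the left hand side decays only polynomially.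
  have hz := (tendsto_pow_const_mul_const_pow_of_abs_lt_one d
    (by rwa [abs_of_nonneg hρ0] : |ρ| < 1)).const_mul (2 ^ d : ℝ)
  rw [mul_zero] at hz
  obtain ⟨R, hR1, hR⟩ := ((hz.eventually (gt_mem_nhds one_pos)).and
    (eventually_gt_atTop 0)).exists
  have h4 : (4 : ℝ) ^ R ≤ 2 * R * R.centralBinom := by
    exact_mod_cast Nat.four_pow_le_two_mul_self_mul_centralBinom R hR
  have hR0 : (0 : ℝ) < R := by exact_mod_cast hR
  have h5 : 1 ≤ 2 * R * ((R.centralBinom : ℝ) / 4 ^ R) := by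
    rw [← mul_div_assoc, le_div_iff₀ (by positivity), one_mul]; exact h4
  have h6 : (1 : ℝ) ≤ (2 * R) ^ d * ρ ^ R := by
    calc (1 : ℝ) ≤ (2 * R * ((R.centralBinom : ℝ) / 4 ^ R)) ^ d := one_le_pow₀ h5
      _ = (2 * R) ^ d * ((R.centralBinom : ℝ) / 4 ^ R) ^ d := mul_pow _ _ _
      _ ≤ _ := mul_le_mul_of_nonneg_left (main R) (by positivity)
  rw [mul_pow] at h6
  linarith

/-! ### Rational ratios and Pisot numbers -/

section

open Polynomial IntermediateField

/-- If `u ∉ ℚ(θ)` for a Pisot number `θ`, the finite subsums of `u θ ^ (p i)` come close to every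
coset of the set of elements of `ℤ[θ]` with small other conjugates. -/
theorem exists_finset_sum_near_coset {θ u : ℝ} (hθ : IsPisot θ) {p : ℕ} (hp : p ≠ 0)
    (hu : u ∉ ℚ⟮θ⟯) (g : ℝ) {η : ℝ} (hη : 0 < η) :
    ∃ (S : Finset ℕ) (P : ℤ[X]), ConjBounded θ 1 P ∧
      |∑ i ∈ S, u * (θ ^ p) ^ i - g - aeval θ P| < η := by
  obtain ⟨d, κ, ε, hκ, hε, hnear⟩ := exists_conjBounded_near_of_near_int hθ.1 hη
  obtain ⟨S, hS⟩ := exists_finset_sum_near_int κ (fun i => u * (θ ^ p) ^ i) g (fun m hm ht => by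
    have hξ : ∑ j, (m j : ℝ) * κ j ∈ ℚ⟮θ⟯ :=
      sum_mem fun j _ => mul_mem (intCast_mem _ _) (hκ j)
    simp only [← mul_assoc] at ht
    have h1 := mem_adjoin_of_tendsto_sub_round (hθ.1.pow p) (one_lt_pow₀ hθ.2.1 hp) ht
    have h2 : ℚ⟮θ ^ p⟯ ≤ ℚ⟮θ⟯ :=
      adjoin_simple_le_iff.2 (pow_mem (mem_adjoin_simple_self ℚ θ) p)
    apply hu
    have := div_mem (h2 h1) hξ
    rwa [mul_div_cancel_left₀ _ hm] at this) hε
  obtain ⟨P, hP, hlt⟩ := hnear _ hS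
  exact ⟨S, P, hP, hlt⟩

/-- If `1 / α` is a Pisot number and `β ^ q = α ^ p`, then the sides `c β ^ r` of an embedding of
`K_β` into `K_α` lie in `ℚ(α)`: otherwise their subsums along the powers of `α ^ p` would meet every
coset, contrary to `exists_coset_avoided`. -/
theorem mul_pow_mem_adjoin_of_pow_eq_pow {α β x c : ℝ} (hα0 : 0 < α) (hα : α < 1 / 2)
    (hβ0 : 0 < β) (hθ : IsPisot (1 / α)) {p q : ℕ} (hp : p ≠ 0) (hq : q ≠ 0)
    (hpq : β ^ q = α ^ p)
    (hK : ∀ S : Finset ℕ, x + c * ∑ n ∈ S, β ^ n ∈ digitSums α) (r : ℕ) :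
    c * β ^ r ∈ ℚ⟮1 / α⟯ := by
  classical
  by_contra hu
  obtain ⟨k, J, hkJ⟩ := exists_coset_avoided hα0 hα hθ 1
  set θ := 1 / α with hθd
  have hθ0 : 0 < θ := by positivity
  have hθα : θ * α = 1 := by rw [hθd]; field_simp
  have hθk : 0 < θ ^ k := by positivity
  have hu' : c * β ^ r / θ ^ k ∉ ℚ⟮θ⟯ := fun h => hu (by
    have := mul_mem h (pow_mem (mem_adjoin_simple_self ℚ θ) k)
    rwa [div_mul_cancel₀ _ hθk.ne'] at this)
  have key := fun j : ℕ => exists_finset_sum_near_coset hθ hp hu' (6 * j / θ ^ k)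
    (η := 1 / θ ^ k) (by positivity)
  choose S P hP hlt using key
  -- The blow-up by `θ ^ (p I)` turns `c β ^ (r + q (I - i))` into `c β ^ r θ ^ (p i)`.
  set I := (Finset.range J).sup (fun j => (S j).sup id) + k with hI
  have hkI : k ≤ p * I := by
    have : 1 ≤ p := Nat.one_le_iff_ne_zero.2 hp
    nlinarith
  obtain ⟨N, hN⟩ : ∃ N, p * I = N + k := ⟨p * I - k, by omega⟩
  refine hkJ N x (by simpa using hK ∅) fun j hj => ?_
  have hiI : ∀ i ∈ S j, i ≤ I := by
    intro i hi
    have h1 : i ≤ (S j).sup id := Finset.le_sup (f := id) hi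
    have h2 : (S j).sup id ≤ (Finset.range J).sup (fun j => (S j).sup id) :=
      Finset.le_sup (f := fun j => (S j).sup id) (Finset.mem_range.2 hj)
    omega
  refine ⟨_, hK ((S j).image fun i => r + q * (I - i)), P j, hP j, ?_⟩
  have hsum : θ ^ (N + k) * (c * ∑ n ∈ (S j).image fun i => r + q * (I - i), β ^ n) =
      θ ^ k * ∑ i ∈ S j, c * β ^ r / θ ^ k * (θ ^ p) ^ i := by
    rw [Finset.sum_image (fun a ha b hb hab => by
      have h1 := hiI a ha
      have h2 := hiI b hb
      have h3 : q * (I - a) = q * (I - b) := by simpa using hab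
      have h4 := Nat.eq_of_mul_eq_mul_left (Nat.pos_of_ne_zero hq) h3
      omega), Finset.mul_sum, Finset.mul_sum, Finset.mul_sum]
    refine Finset.sum_congr rfl fun i hi => ?_
    have h1 : θ ^ (N + k) = (θ ^ p) ^ i * (θ ^ p) ^ (I - i) := by
      rw [← hN, ← pow_add, Nat.add_sub_cancel' (hiI i hi), pow_mul]
    have h2 : (θ ^ p) ^ (I - i) * β ^ (q * (I - i)) = 1 := by
      rw [pow_mul, hpq, ← mul_pow, ← mul_pow, hθα, one_pow, one_pow]
    rw [h1, pow_add]
    have h3 : θ ^ k * (c * β ^ r / θ ^ k * (θ ^ p) ^ i) = c * β ^ r * (θ ^ p) ^ i := by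
      field_simp
    rw [h3]
    linear_combination (θ ^ p) ^ i * c * β ^ r * h2
  have e : θ ^ (N + k) * (x + c * ∑ n ∈ (S j).image (fun i => r + q * (I - i)), β ^ n - x) -
      6 * j - θ ^ k * aeval θ (P j) = θ ^ k * (∑ i ∈ S j, c * β ^ r / θ ^ k * (θ ^ p) ^ i -
        6 * j / θ ^ k - aeval θ (P j)) := by
    rw [add_sub_cancel_left, hsum]
    field_simp
  rw [e, abs_mul, abs_of_pos hθk]
  have := mul_lt_mul_of_pos_left (hlt j) hθk
  rwa [mul_one_div_cancel hθk.ne'] at this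

/-- A number `b > 1` in `ℚ(θ)` such that a power of it is a positive power of the Pisot number `θ`
is a Pisot number. -/
theorem IsPisot.of_pow_eq_pow {θ b : ℝ} (hθ : IsPisot θ) (hb1 : 1 < b) {p q : ℕ} (hp : p ≠ 0)
    (hq : q ≠ 0) (hpq : b ^ q = θ ^ p) (hb : b ∈ ℚ⟮θ⟯) : IsPisot b := by
  have hbint : IsIntegral ℤ b :=
    IsIntegral.of_pow (Nat.pos_of_ne_zero hq) (hpq ▸ hθ.1.pow p)
  refine ⟨hbint, hb1, fun z hz hzb => ?_⟩
  have hθQ : IsIntegral ℚ θ := hθ.1.tower_top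
  have : FiniteDimensional ℚ ℚ⟮θ⟯ := adjoin.finiteDimensional hθQ
  set b' : ℚ⟮θ⟯ := ⟨b, hb⟩ with hb'
  have hmin : minpoly ℚ b' = minpoly ℚ b :=
    (minpoly.algebraMap_eq (algebraMap ℚ⟮θ⟯ ℝ).injective b').symm
  have hroot : z ∈ (minpoly ℚ b').rootSet ℂ := by
    rw [hmin]
    exact mem_rootSet.2 ⟨minpoly.ne_zero hbint.tower_top, hz⟩
  rw [← Algebra.IsAlgebraic.range_eval_eq_rootSet_minpoly] at hroot
  obtain ⟨φ, rfl⟩ := hroot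
  have hpq' : b' ^ q = AdjoinSimple.gen ℚ θ ^ p := by
    apply (algebraMap ℚ⟮θ⟯ ℝ).injective
    rw [map_pow, map_pow, AdjoinSimple.algebraMap_gen]
    exact hpq
  have hφ : φ b' ^ q = φ (AdjoinSimple.gen ℚ θ) ^ p := by rw [← map_pow, hpq', map_pow]
  have hne : φ (AdjoinSimple.gen ℚ θ) ≠ (θ : ℂ) := by
    intro h
    -- an embedding fixing `θ` is the inclusion
    have h1 : φ = (Complex.ofRealAm.restrictScalars ℚ).comp ℚ⟮θ⟯.val := by
      refine adjoin_algHom_ext ℚ fun x hx => ?_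
      obtain rfl := Set.mem_singleton_iff.1 hx
      exact h
    apply hzb
    rw [h1]
    rfl
  have hlt : ‖φ (AdjoinSimple.gen ℚ θ)‖ < 1 := by
    refine hθ.2.2 _ ?_ hne
    have h := congrArg (φ : ℚ⟮θ⟯ →+* ℂ) (aeval_gen_minpoly ℚ θ)
    rwa [map_zero, aeval_def, hom_eval₂, RingHom.ext_rat (RingHom.comp _ _) (algebraMap ℚ ℂ),
      ← aeval_def] at h
  have hn : ‖φ b'‖ ^ q < 1 := by
    rw [← norm_pow, hφ, norm_pow]
    exact pow_lt_one₀ (norm_nonneg _) hlt hp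
  by_contra hge
  exact absurd (one_le_pow₀ (not_lt.1 hge)) (not_le.2 hn)

/-- The quotient `c / (c β)` of two sides of the embedding exhibits `1 / β` as an element of
`ℚ(1 / α)`. -/
theorem isPisot_of_affinelyEmbeds {α β : ℝ} (hβ0 : 0 < β) (hβα : β < α) (hα : α < 1 / 2)
    (hθ : IsPisot (1 / α)) (h : AffinelyEmbeds (centralCantorSet β) (centralCantorSet α)) :
    IsPisot (1 / β) := by
  have hα0 : 0 < α := hβ0.trans hβα
  obtain ⟨s, hs⟩ := exists_rat_of_isPisot hβ0 hβα hα hθ h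
  obtain ⟨x, c, hc, hK⟩ :=
    exists_finsum_mem_of_affinelyEmbeds hβ0 (by linarith) hα0 (by linarith) h
  have hla : Real.log α < 0 := Real.log_neg hα0 (by linarith)
  have hlb : Real.log β < 0 := Real.log_neg hβ0 (by linarith)
  have hs0 : 0 < s := by
    have : (0 : ℝ) < s := hs ▸ div_pos_of_neg_of_neg hlb hla
    exact_mod_cast this
  obtain ⟨p, hp⟩ : ∃ p : ℕ, s.num = p := Int.eq_ofNat_of_zero_le (Rat.num_pos.2 hs0).le
  have hp0 : p ≠ 0 := by
    rintro rfl
    exact (Rat.num_pos.2 hs0).ne' hp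
  have hpq : β ^ s.den = α ^ p := by
    refine Real.log_injOn_pos (Set.mem_Ioi.2 (by positivity)) (Set.mem_Ioi.2 (by positivity)) ?_
    have hsd : (s : ℝ) = p / s.den := by
      rw [Rat.cast_def, hp, Int.cast_natCast]
    have hd : (s.den : ℝ) ≠ 0 := by exact_mod_cast s.den_nz
    rw [hsd, div_eq_div_iff hla.ne hd] at hs
    rw [Real.log_pow, Real.log_pow]
    linarith
  have hmem := mul_pow_mem_adjoin_of_pow_eq_pow hα0 hα hβ0 hθ hp0 s.den_nz hpq hK
  have hb : 1 / β ∈ ℚ⟮1 / α⟯ := by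
    have := div_mem (hmem 0) (hmem 1)
    convert! this using 1
    field_simp
  refine hθ.of_pow_eq_pow ?_ hp0 s.den_nz ?_ hb
  · rw [lt_div_iff₀ hβ0]; linarith
  · rw [div_pow, div_pow, hpq, one_pow, one_pow]

end

theorem theorem1p4 :
    (∀ α β : ℝ, 0 < β → β < α → α < 1 / 4 →
      (AffinelyEmbeds (centralCantorSet β) (centralCantorSet α) ↔
        ∃ n : ℕ, Real.log β / Real.log α = (n : ℝ))) ∧
    (∀ α β : ℝ, 0 < β → β < α → 1 / 4 ≤ α → α < √2 - 1 →
      AffinelyEmbeds (centralCantorSet β) (centralCantorSet α) →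
        ∃ q : ℚ, Real.log β / Real.log α = (q : ℝ)) ∧
    (∃ α β : ℝ, 0 < β ∧ β < α ∧ 1 / 4 ≤ α ∧ α < √2 - 1 ∧
      AffinelyEmbeds (centralCantorSet β) (centralCantorSet α) ∧
        ¬ ∃ n : ℕ, Real.log β / Real.log α = (n : ℝ)) ∧
    (∀ α β : ℝ, 0 < β → β < α → α < 1 / 2 → IsPisot (1 / α) →
      AffinelyEmbeds (centralCantorSet β) (centralCantorSet α) →
        (∃ q : ℚ, Real.log β / Real.log α = (q : ℝ)) ∧ IsPisot (1 / β)) := by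
  refine ⟨fun α β hβ0 hβα hα => ⟨exists_nat_of_affinelyEmbeds hβ0 hβα hα, ?_⟩,
    fun α β hβ0 hβα _ hα h => exists_rat_of_lt_sqrt_two_sub_one hβ0 hβα hα h,
    exists_affinelyEmbeds_of_not_nat,
    fun α β hβ0 hβα hα hθ h => ⟨exists_rat_of_isPisot hβ0 hβα hα hθ h,
      isPisot_of_affinelyEmbeds hβ0 hβα hα hθ h⟩⟩
  rintro ⟨n, hn⟩
  have hα0 : 0 < α := hβ0.trans hβα
  have hla : Real.log α < 0 := Real.log_neg hα0 (by linarith)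
  have hβ : β = α ^ n := by
    refine Real.log_injOn_pos (Set.mem_Ioi.2 hβ0) (Set.mem_Ioi.2 (by positivity)) ?_
    rw [Real.log_pow, ← hn, div_mul_cancel₀ _ hla.ne]
  have hn0 : n ≠ 0 := by
    rintro rfl
    rw [pow_zero] at hβ
    linarith
  rw [hβ]
  exact affinelyEmbeds_pow hα0 (by linarith) hn0
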